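/- Let $V$ be a vector space of finite dimension $n$ over a division ring, $W$ a subspace of $V$, and $k,m$ integers with $0\le m$ and $k-\operatorname{codim}(W)\le m\le \min\{k,\dim W\}$. The Grassmann space of $k$-subspaces of $V$ has the $k$-dimensional subspaces of $V$ as points and the sets $\{U : \dim U=k,\ H\subset U\subset B\}$ with $H\subset B$, $\dim H=k-1$, $\dim B=k+1$, as lines. The spine space $\mathfrak M$ has as (proper) points the $k$-subspaces $U$ with $\dim(U\cap W)=m$, and as lines the traces, with at least two points, of the lines of the Grassmann space on this point set; the other points of the Grassmann space are called improper. Let $\mathcal L$ be the set of lines of $\mathfrak M$. A subspace of a point-line space is a set of points that contains every line with which it shares at least two points. It is strong if any two of its points are collinear. For a set $X$ of points of $\mathfrak M$ let $\overline X$ be the least subspace of the Grassmann space containing $X$. A plane of the Grassmann space is a strong subspace on which the induced geometry is a projective plane; a plane of $\mathfrak M$ is a subspace $E$ of $\mathfrak M$ such that $\overline E$ is a plane of the Grassmann space. For a plane $E$ of $\mathfrak M$ and $U\in\overline E$ put $\mathbf p(U,E)=\{L\in\mathcal L : U\in\overline L\subseteq\overline E\}$; this is a pencil of lines if $U$ is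 proper and a parallel pencil if $U$ is improper. Let $\mathcal P$ and $\mathcal P_\parallel$ be the families of all pencils of lines and of all parallel pencils. For $L_1,L_2\in\mathcal L$ write $L_1\mathrel{\pi}L_2$ if some plane of $\mathfrak M$ contains $L_1$ and $L_2$, and $L_1\mathrel{\rho}L_2$ if some pencil in $\mathcal P$ contains both as elements. A family $\mathcal F$ of subsets of $\mathcal L$ is definable in $\langle\mathcal L,\delta\rangle$ if there are first-order formulas $\psi(a_1,\dots,a_r)$ and $\varphi(x,a_1,\dots,a_r)$, without parameters, in the language with one binary relation symbol, such that the members of $\mathcal F$ are exactly the sets $\{x\in\mathcal L : \varphi(x,a)\}$ with $a\in\mathcal L^r$ satisfying $\psi$ in $\langle\mathcal L,\delta\rangle$. Proposition. If $3\le n-k$ and $3\le k-m$, then: 1. the families $\mathcal P\cup\mathcal P_\parallel$, $\mathcal P_\parallel$ and $\mathcal P$ are definable in $\langle\mathcal L,\pi\rangle$; 2. the family $\mathcal P$ is definable in $\langle\mathcal L,\rho\rangle$. In particular, the geometry of pencils $\langle\mathcal L,\mathcal P\rangle$ is definable in $\langle\mathcal L,\delta\rangle$ for each $\delta\in\{\pi,\rho\}$.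 -/

import Mathlib

open Module

namespace LinePencils

/-! ### Point-line spaces

A point-line space is given by its point type `P` and its family `𝓛 : Set (Set P)` of lines. -/

section PointLine

variable {P : Type*}

/-- A subspace: every line that shares at least two points with `X` is contained in `X`. -/
def IsSubspace (𝓛 : Set (Set P)) (X : Set P) : Prop :=
  ∀ l ∈ 𝓛, (l ∩ X).Nontrivial → l ⊆ X

/-- Any two distinct points of `X` lie on a common line. -/
def PairwiseCollinear (𝓛 : Set (Set P)) (X : Set P) : Prop :=
  ∀ a ∈ X, ∀ b ∈ X, a ≠ b → ∃ l ∈ 𝓛, a ∈ l ∧ b ∈ l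

/-- A strong subspace. -/
def IsStrong (𝓛 : Set (Set P)) (X : Set P) : Prop :=
  IsSubspace 𝓛 X ∧ PairwiseCollinear 𝓛 X

/-- Incidence between the points of `X` and the lines contained in `X`. -/
@[reducible] def restrictMembership (𝓛 : Set (Set P)) (X : Set P) :
    Membership X {l : Set P // l ∈ 𝓛 ∧ l ⊆ X} :=
  ⟨fun l p => (p : P) ∈ l.1⟩

/-- The restriction of the point-line space to `X` is a projective plane. -/
def RestrictsToProjectivePlane (𝓛 : Set (Set P)) (X : Set P) : Prop :=
  Nonempty (@Configuration.ProjectivePlane X {l : Set P // l ∈ 𝓛 ∧ l ⊆ X}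
    (restrictMembership 𝓛 X))

/-- A plane: a strong subspace on which the induced geometry is a projective plane. -/
def IsPlane (𝓛 : Set (Set P)) (E : Set P) : Prop :=
  IsStrong 𝓛 E ∧ RestrictsToProjectivePlane 𝓛 E

/-- The closure of `X`: the least subspace of the ambient space that contains `X`. If `X` is a line
of a fragment, this is the unique line of the ambient space that contains `X`. -/
def spClosure (𝓛 : Set (Set P)) (X : Set P) : Set P :=
  ⋂₀ {Y | IsSubspace 𝓛 Y ∧ X ⊆ Y}

/-! ### Fragments

The fragment of the space with lines `𝓛` on the set `S` of proper points. -/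

/-- The lines of the fragment: the traces on `S`, with at least two points, of ambient lines. -/
def fragmentLines (𝓛 : Set (Set P)) (S : Set P) : Set (Set P) :=
  {L | ∃ l ∈ 𝓛, L = l ∩ S ∧ L.Nontrivial}

/-- A plane of the fragment: a subspace of the fragment whose closure is an ambient plane. -/
def IsFragmentPlane (𝓛 : Set (Set P)) (S E : Set P) : Prop :=
  E ⊆ S ∧ IsSubspace (fragmentLines 𝓛 S) E ∧ IsPlane 𝓛 (spClosure 𝓛 E)

/-- The relation `π` on the lines of the fragment: the two lines lie on a common plane. -/
def Coplanar (𝓛 : Set (Set P)) (S : Set P) (L₁ L₂ : fragmentLines 𝓛 S) : Prop :=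
  ∃ E, IsFragmentPlane 𝓛 S E ∧ L₁.1 ⊆ E ∧ L₂.1 ⊆ E

/-- The set `p(U, E)` of the lines of the fragment whose closure passes through `U` and is
contained in the closure of `E`. -/
def pencilAt (𝓛 : Set (Set P)) (S : Set P) (U : P) (E : Set P) : Set (fragmentLines 𝓛 S) :=
  {L | U ∈ spClosure 𝓛 L.1 ∧ spClosure 𝓛 L.1 ⊆ spClosure 𝓛 E}

/-- The family of all pencils of lines `p(U, E)`: the vertex `U` is a proper point. -/
def properPencils (𝓛 : Set (Set P)) (S : Set P) : Set (Set (fragmentLines 𝓛 S)) :=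
  {p | ∃ E U, IsFragmentPlane 𝓛 S E ∧ U ∈ spClosure 𝓛 E ∧ U ∈ S ∧ p = pencilAt 𝓛 S U E}

/-- The family of all parallel pencils `p(U, E)`: the vertex `U` is an improper point. -/
def parallelPencils (𝓛 : Set (Set P)) (S : Set P) : Set (Set (fragmentLines 𝓛 S)) :=
  {p | ∃ E U, IsFragmentPlane 𝓛 S E ∧ U ∈ spClosure 𝓛 E ∧ U ∉ S ∧ p = pencilAt 𝓛 S U E}

/-- The relation `ρ` on the lines of the fragment: the two lines lie in a common pencil with a
proper vertex. -/
def Copencil (𝓛 : Set (Set P)) (S : Set P) (L₁ L₂ : fragmentLines 𝓛 S) : Prop :=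
  ∃ p ∈ properPencils 𝓛 S, L₁ ∈ p ∧ L₂ ∈ p

end PointLine

/-! ### Grassmann spaces and spine spaces -/

section Grassmann

variable (K V : Type*) [DivisionRing K] [AddCommGroup V] [Module K V]

/-- The set `Sub_k(V)` of all `k`-dimensional subspaces of `V`. -/
abbrev Grass (k : ℕ) : Type _ := {U : Submodule K V // finrank K U = k}

/-- The `k`-pencils `{U : H ⊆ U ⊆ B}` with `H ⊆ B`, `dim H = k - 1`, `dim B = k + 1`: the lines
of the Grassmann space. -/
def grassLines (k : ℕ) : Set (Set (Grass K V k)) :=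
  {l | ∃ H B : Submodule K V, finrank K H + 1 = k ∧ finrank K B = k + 1 ∧ H ≤ B ∧
    l = {U | H ≤ U.1 ∧ U.1 ≤ B}}

variable {K V}

/-- The points of the spine space: the `k`-dimensional `U` with `dim (U ∩ W) = m`. -/
def spinePoints (k m : ℕ) (W : Submodule K V) : Set (Grass K V k) :=
  {U | finrank K (U.1 ⊓ W : Submodule K V) = m}

/-- The lines of the spine space. -/
abbrev SpineLine (k m : ℕ) (W : Submodule K V) : Type _ :=
  fragmentLines (grassLines K V k) (spinePoints k m W)

/-- Coplanarity `π` of lines of the spine space. -/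
def spinePi (k m : ℕ) (W : Submodule K V) : SpineLine k m W → SpineLine k m W → Prop :=
  Coplanar (grassLines K V k) (spinePoints k m W)

/-- The relation `ρ` of being in one pencil of lines, for lines of the spine space. -/
def spineRho (k m : ℕ) (W : Submodule K V) : SpineLine k m W → SpineLine k m W → Prop :=
  Copencil (grassLines K V k) (spinePoints k m W)

/-- The family `𝒫` of all pencils of lines (with proper vertex) in the spine space. -/
def spinePencils (k m : ℕ) (W : Submodule K V) : Set (Set (SpineLine k m W)) :=
  properPencils (grassLines K V k) (spinePoints k m W)

/-- The family of all parallel pencils in the spine space. -/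
def spineParallelPencils (k m : ℕ) (W : Submodule K V) : Set (Set (SpineLine k m W)) :=
  parallelPencils (grassLines K V k) (spinePoints k m W)

end Grassmann

/-! ### First-order definability in a structure `⟨X, R⟩` with one binary relation -/

section Definability

/-- The relation symbols: one, of arity two. -/
inductive BinSymb : ℕ → Type
  | rel : BinSymb 2

/-- The first-order language with one binary relation symbol. -/
def binLang : FirstOrder.Language.{0, 0} := ⟨fun _ => Empty, BinSymb⟩

/-- The structure `⟨X, R⟩`. -/
@[reducible] def binStructure {X : Type*} (R : X → X → Prop) : binLang.Structure X where
  funMap := fun f => Empty.elim f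
  RelMap := fun r v => match r, v with
    | BinSymb.rel, v => R (v 0) (v 1)

/-- The relation `D` on `X` is first-order definable without parameters in `⟨X, R⟩`. -/
def DefinableIn {X : Type*} (R : X → X → Prop) {r : ℕ} (D : Set (Fin r → X)) : Prop :=
  @Set.Definable X ∅ binLang (binStructure R) (Fin r) D

/-- The family `F` of subsets of `X` is definable in `⟨X, R⟩`: there are first-order formulas
`ψ(a₁, …, aᵣ)` and `φ(x, a₁, …, aᵣ)` without parameters such that the members of `F` are exactly
the sets `{x : φ(x, a)}` where `a` runs through the tuples that satisfy `ψ`. -/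
def DefinableFamily {X : Type*} (R : X → X → Prop) (F : Set (Set X)) : Prop :=
  ∃ (r : ℕ) (D : Set (Fin r → X)) (T : Set (Fin (r + 1) → X)),
    DefinableIn R D ∧ DefinableIn R T ∧
    F = {p | ∃ a ∈ D, p = {x | (Fin.cons x a : Fin (r + 1) → X) ∈ T}}

end Definability

end LinePencils

/-!
A line of the spine space is the trace of `{U : H ≤ U ≤ B}` for a pair `(H, B)` of subspaces with
`dim H = k - 1`, `dim B = k + 1`; the dimensions of `H ⊓ W` and `B ⊓ W` decide whether the trace
has two points. A plane of the spine space lies in the star of some `H` (all its lines have that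
`H`) or in the top of some `B`. So two lines are coplanar iff they share `H` or `B` and their
closures meet, and they are in `ρ` iff moreover they meet in a proper point (`spinePi_eq`,
`spineRho_eq`).

The lines in a star or a top are those of a slit space: a projective space in which the lines
inside one subspace, the slit, are removed. For a top the order of the lattice of subspaces is
reversed. Both cases are handled at once by proving the incidence geometry of slit spaces in a
`RankedLattice`, of which the lattice of subspaces and its order dual are instances. Tops always
have rank at least four, because `3 ≤ k - m`; stars have rank at least four, because `3 ≤ n - k`,
or have no slit.

*Four-cycles.* That two lines share `H` or `B` is definable: they are both related to two distinct
related lines (`LineCoords.sameSheet_iff`). An induced four-cycle of this relation consists of the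
lines `(H, B)`, `(H, B')`, `(H', B')`, `(H', B)`, and these all pass through `H ⊔ H' = B ⊓ B'`
(`LineCoords.exists_thru_of_rect`). So four-cycles transport the point in which two lines meet
from a star to a top and back.

*Pencils.* In a slit space of rank at least four, a line is in the pencil of two intersecting
lines iff it meets every line meeting both (`RankedLattice.forall_meet_iff`). This fails only in
stars that are projective planes. Such stars are recognized by all common transversals meeting
each other, and concurrency in them is certified by two four-cycles with a common side. Together
this gives a formula `InPencil` (`inPencil_iff`), with two distinct coplanar lines as parameters,
which defines the family of all pencils.

*Improper vertices.* For a proper point `U`, the Veblen axiom, read in the residue of lines and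
pencils, holds at all pairs of lines through `U` (`RankedLattice.exists_slitLine_of_veblen`),
since a line through `U` is not in the slit. At an improper point it fails as soon as the slit is
not a single point (`RankedLattice.exists_veblen_failure`): the two pencils in an affine plane
whose vertices are on the line at infinity have no common line. The slit of a top through an
improper point has rank at least two, because `3 ≤ k - m`; a pencil in a star is first transported
to a top by a four-cycle. This yields a formula for impropriety of the vertex
(`LineCoords.improper_iff`).

*From `ρ` to `π`.* Coplanar lines that are not in `ρ` meet in an improper point. Through such a
point all pairs `(H, B)` of the subspaces in question are lines, so the two lines are consecutive
in a four-cycle, and `π` is definable in terms of `ρ` (`LineCoords.coplanarFrom_iff`).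
-/

namespace LinePencils

/-! ### Ranked lattices -/

/-- A lattice with a strictly monotone modular rank function in which an interval `[a, b]` has, for
any two elements `x ≥ a` and `y`, neither of them above `b`, an atom that lies below neither of
them. Both the
lattice of subspaces of a finite-dimensional space and its order dual are of this kind, so that what
is proved here for stars holds for tops as well. -/
class RankedLattice (Λ : Type*) [Lattice Λ] where
  /-- The rank function. -/
  rk : Λ → ℕ
  rk_lt : ∀ {a b : Λ}, a < b → rk a < rk b
  rk_sup_add_inf : ∀ a b : Λ, rk (a ⊔ b) + rk (a ⊓ b) = rk a + rk b
  exists_atom : ∀ {a b x y : Λ}, a ≤ b → a ≤ x → ¬ b ≤ x → ¬ b ≤ y →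
    ∃ p, a ≤ p ∧ p ≤ b ∧ rk p = rk a + 1 ∧ ¬ p ≤ x ∧ ¬ p ≤ y

namespace RankedLattice

variable {Λ : Type*} [Lattice Λ] [RankedLattice Λ] {a b c u v x y p q : Λ}

theorem rk_mono (h : a ≤ b) : rk a ≤ rk b := by
  rcases h.eq_or_lt with rfl | h
  · exact le_rfl
  · exact (rk_lt h).le

theorem eq_of_le_of_rk_le (h : a ≤ b) (hr : rk b ≤ rk a) : a = b := by
  rcases h.eq_or_lt with rfl | h
  · rfl
  · exact absurd (rk_lt h) (by omega)

theorem exists_between {r : ℕ} (h : a ≤ b) (har : rk a ≤ r) (hrb : r ≤ rk b) :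
    ∃ c, a ≤ c ∧ c ≤ b ∧ rk c = r := by
  induction r, har using Nat.le_induction with
  | base => exact ⟨a, le_rfl, h, rfl⟩
  | succ r har ih =>
    obtain ⟨c, hac, hcb, hc⟩ := ih (by omega)
    have hn : ¬ b ≤ c := fun hbc => by have := rk_mono hbc; omega
    obtain ⟨p, hp, hpb, hpr, -⟩ := exists_atom hcb le_rfl hn hn
    exact ⟨p, hac.trans hp, hpb, by omega⟩

/-- Two distinct points over `a` span a line over `a`. -/
theorem rk_sup_of_ne (hu : a ≤ u) (hv : a ≤ v) (hur : rk u = rk a + 1) (hvr : rk v = rk a + 1)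
    (hne : u ≠ v) : rk (u ⊔ v) = rk a + 2 := by
  have h1 := rk_sup_add_inf u v
  have h2 := rk_mono (le_inf hu hv)
  by_contra hcon
  have h3 : u ⊓ v = u := eq_of_le_of_rk_le inf_le_left (by omega)
  exact hne (eq_of_le_of_rk_le (inf_eq_left.1 h3) (by omega))

/-- The line through two distinct points is determined by them. -/
theorem eq_sup_of_ne (hu : a ≤ u) (hv : a ≤ v) (hur : rk u = rk a + 1) (hvr : rk v = rk a + 1)
    (hne : u ≠ v) (hub : u ≤ b) (hvb : v ≤ b) (hb : rk b = rk a + 2) : u ⊔ v = b :=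
  eq_of_le_of_rk_le (sup_le hub hvb) (by rw [rk_sup_of_ne hu hv hur hvr hne, hb])

/-- The dual of `rk_sup_of_ne` in an interval of length two. -/
theorem eq_inf_of_ne (hur : rk u + 1 = rk b) (hvr : rk v + 1 = rk b)
    (hne : u ≠ v) (hu : a ≤ u) (hv : a ≤ v) (hb : rk b = rk a + 2) : u ⊓ v = a := by
  have h1 := rk_sup_of_ne hu hv (by omega) (by omega) hne
  have h2 := rk_sup_add_inf u v
  exact (eq_of_le_of_rk_le (le_inf hu hv) (by omega)).symm

/-- In particular, two lines of a plane meet. -/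
theorem rk_le_rk_inf (hx : x ≤ c) (hy : y ≤ c) : rk x + rk y ≤ rk (x ⊓ y) + rk c := by
  have := rk_sup_add_inf x y
  have := rk_mono (sup_le hx hy)
  omega

theorem rk_inf_lt (hx : ¬ x ≤ y) : rk (x ⊓ y) < rk x := by
  by_contra h
  exact hx (inf_eq_left.1 (eq_of_le_of_rk_le inf_le_left (not_lt.1 h)))

/-- A line that meets both of two intersecting lines passes through their common point or lies in
their plane. -/
theorem inf_le_or_le_sup {r : ℕ} (hc : rk c = r + 2) (hab : rk (a ⊓ b) = r + 1)
    (hca : r + 1 ≤ rk (c ⊓ a)) (hcb : r + 1 ≤ rk (c ⊓ b)) : a ⊓ b ≤ c ∨ c ≤ a ⊔ b := by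
  by_cases h : r + 2 ≤ rk ((c ⊓ a) ⊔ (c ⊓ b))
  · right
    have : (c ⊓ a) ⊔ (c ⊓ b) = c :=
      eq_of_le_of_rk_le (sup_le inf_le_left inf_le_left) (by omega)
    rw [← this]
    exact sup_le_sup inf_le_right inf_le_right
  · left
    have h1 : c ⊓ a = (c ⊓ a) ⊔ (c ⊓ b) := eq_of_le_of_rk_le le_sup_left (by omega)
    have h2 : c ⊓ b ≤ c ⊓ a := h1 ▸ le_sup_right
    have h3 : c ⊓ b = a ⊓ b := eq_of_le_of_rk_le
      (le_inf (h2.trans inf_le_right) inf_le_right) (by omega)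
    exact h3 ▸ inf_le_left

/-- A line through a point `u` of a plane `y` but not in the plane does not meet the lines of the
plane that avoid `u`. -/
theorem not_meet {m n : Λ} {r : ℕ} (hum : u ≤ m) (huy : u ≤ y) (hu : rk u = r + 1)
    (hm : rk m = r + 2) (hmy : ¬ m ≤ y) (hny : n ≤ y) (hun : ¬ u ≤ n) :
    ¬ r + 1 ≤ rk (m ⊓ n) := by
  intro h
  have h1 := rk_inf_lt hmy
  have h2 : u = m ⊓ y := eq_of_le_of_rk_le (le_inf hum huy) (by omega)
  have h3 : m ⊓ n = m ⊓ y := eq_of_le_of_rk_le (inf_le_inf_left _ hny) (by omega)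
  exact hun (h2.le.trans (h3.ge.trans inf_le_right))

/-- The configuration required in the axioms of a projective plane, in an interval of length
three. -/
theorem exists_config (hay : a ≤ y) (hy : rk y = rk a + 3) :
    ∃ p₁ p₂ p₃ l₁ l₂ l₃ : Λ,
      ((a ≤ p₁ ∧ p₁ ≤ y ∧ rk p₁ = rk a + 1) ∧ (a ≤ p₂ ∧ p₂ ≤ y ∧ rk p₂ = rk a + 1) ∧
        (a ≤ p₃ ∧ p₃ ≤ y ∧ rk p₃ = rk a + 1)) ∧
      ((a ≤ l₁ ∧ l₁ ≤ y ∧ rk l₁ = rk a + 2) ∧ (a ≤ l₂ ∧ l₂ ≤ y ∧ rk l₂ = rk a + 2) ∧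
        (a ≤ l₃ ∧ l₃ ≤ y ∧ rk l₃ = rk a + 2)) ∧
      ¬ p₁ ≤ l₂ ∧ ¬ p₁ ≤ l₃ ∧ ¬ p₂ ≤ l₁ ∧ p₂ ≤ l₂ ∧ p₂ ≤ l₃ ∧ ¬ p₃ ≤ l₁ ∧ p₃ ≤ l₂ ∧ ¬ p₃ ≤ l₃ := by
  have hnot : ∀ z : Λ, rk z < rk a + 3 → ¬ y ≤ z := fun z hz h => by
    have := rk_mono h; omega
  have ha := hnot a (by omega)
  obtain ⟨p₁, h1, h1y, h1r, -⟩ := exists_atom hay le_rfl ha ha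
  have hp1 := hnot p₁ (by omega)
  obtain ⟨p₂, h2, h2y, h2r, h21, -⟩ := exists_atom hay h1 hp1 hp1
  have ne12 : p₁ ≠ p₂ := fun h => h21 h.ge
  have r12 := rk_sup_of_ne h1 h2 h1r h2r ne12
  have h12 := hnot (p₁ ⊔ p₂) (by omega)
  obtain ⟨p₃, h3, h3y, h3r, h312, -⟩ := exists_atom hay (h1.trans le_sup_left) h12 h12
  have ne13 : p₁ ≠ p₃ := fun h => h312 (h ▸ le_sup_left)
  have ne23 : p₂ ≠ p₃ := fun h => h312 (h ▸ le_sup_right)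
  have r13 := rk_sup_of_ne h1 h3 h1r h3r ne13
  have r23 := rk_sup_of_ne h2 h3 h2r h3r ne23
  have h13 := hnot (p₁ ⊔ p₃) (by omega)
  have h23 := hnot (p₂ ⊔ p₃) (by omega)
  obtain ⟨l₁, hl1, hl1y, hl1r, ha1, hb1⟩ := exists_atom h1y le_sup_left h12 h13
  obtain ⟨l₃, hl3, hl3y, hl3r, ha3, hb3⟩ := exists_atom h2y le_sup_right h12 h23
  refine ⟨p₁, p₂, p₃, l₁, p₂ ⊔ p₃, l₃, ⟨⟨h1, h1y, h1r⟩, ⟨h2, h2y, h2r⟩, ⟨h3, h3y, h3r⟩⟩,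
    ⟨⟨h1.trans hl1, hl1y, by omega⟩, ⟨h2.trans le_sup_left, sup_le h2y h3y, r23⟩,
      ⟨h2.trans hl3, hl3y, by omega⟩⟩, fun h => ?_, fun h => ?_, fun h => ?_, le_sup_left, hl3,
    fun h => ?_, le_sup_right, fun h => ?_⟩
  · have e : p₁ ⊔ p₂ = p₂ ⊔ p₃ := eq_sup_of_ne h1 h2 h1r h2r ne12 h le_sup_left r23
    exact h312 (e ▸ le_sup_right)
  · exact ha3 (eq_sup_of_ne h1 h2 h1r h2r ne12 h hl3 (by omega)).ge
  · exact ha1 (eq_sup_of_ne h1 h2 h1r h2r ne12 hl1 h (by omega)).ge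
  · exact hb1 (eq_sup_of_ne h1 h3 h1r h3r ne13 hl1 h (by omega)).ge
  · exact hb3 (eq_sup_of_ne h2 h3 h2r h3r ne23 hl3 h (by omega)).ge

/-! ### Slit spaces -/

/-- The lines of the slit space of the interval `[a, t]` of a ranked lattice with the slit `d`: the
lines of the projective space on `[a, t]` that are not contained in the subspace `d`. The points of
the slit space are the elements that cover `a` and lie below `t` but not below `d`. -/
def IsSlitLine (a t d b : Λ) : Prop := a ≤ b ∧ b ≤ t ∧ rk b = rk a + 2 ∧ ¬ b ≤ d

variable {t d l b₁ b₂ : Λ}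

/-- A line through a point of a plane that leaves both the plane and the slit. -/
theorem exists_slitLine_not_le (hau : a ≤ u) (hu : rk u = rk a + 1) (huy : u ≤ y) (hut : u ≤ t)
    (hty : ¬ t ≤ y) (htd : ¬ t ≤ d) : ∃ m, IsSlitLine a t d m ∧ u ≤ m ∧ ¬ m ≤ y := by
  obtain ⟨p, hp, hpt, hpr, hpy, hpd⟩ := exists_atom (hau.trans hut) (hau.trans huy) hty htd
  have hne : u ≠ p := fun h => hpy (h ▸ huy)
  exact ⟨u ⊔ p, ⟨hau.trans le_sup_left, sup_le hut hpt, rk_sup_of_ne hau hp hu hpr hne,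
    fun h => hpd (le_sup_right.trans h)⟩, le_sup_left, fun h => hpy (le_sup_right.trans h)⟩

/-- A line in the plane of two intersecting lines that avoids their common point. -/
theorem exists_slitLine_transversal (h₁ : IsSlitLine a t d b₁) (h₂ : IsSlitLine a t d b₂)
    (hr : rk (b₁ ⊓ b₂) = rk a + 1) :
    ∃ m, IsSlitLine a t d m ∧ m ≤ b₁ ⊔ b₂ ∧ ¬ b₁ ⊓ b₂ ≤ m := by
  obtain ⟨h1a, h1t, h1r, h1d⟩ := h₁
  obtain ⟨h2a, h2t, h2r, h2d⟩ := h₂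
  have hau : a ≤ b₁ ⊓ b₂ := le_inf h1a h2a
  have n1 : ¬ b₁ ≤ b₁ ⊓ b₂ := fun h => by have := rk_mono h; omega
  have n2 : ¬ b₂ ≤ b₁ ⊓ b₂ := fun h => by have := rk_mono h; omega
  obtain ⟨p, hp, hpb, hpr, hpu, hpd⟩ := exists_atom h1a hau n1 h1d
  obtain ⟨q, hq, hqb, hqr, hqu, -⟩ := exists_atom h2a hau n2 h2d
  have hpq : p ≠ q := fun h => hpu (le_inf hpb (h ▸ hqb))
  have r := rk_sup_of_ne hp hq hpr hqr hpq
  refine ⟨p ⊔ q, ⟨hp.trans le_sup_left, sup_le (hpb.trans h1t) (hqb.trans h2t), r,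
    fun h => hpd (le_sup_left.trans h)⟩,
    sup_le (hpb.trans le_sup_left) (hqb.trans le_sup_right), fun h => ?_⟩
  have e1 := eq_sup_of_ne hp hau hpr hr (fun h => hpu h.le) hpb inf_le_left h1r
  have e2 := eq_sup_of_ne hp hau hpr hr (fun h => hpu h.le) le_sup_left h r
  exact hqu (le_inf (le_sup_right.trans (e2.symm.trans e1).le) hqb)

/-- In a slit space of rank at least four, a pencil consists of those lines that meet every line
meeting two given members of the pencil. -/
theorem forall_meet_iff (ht : rk a + 4 ≤ rk t) (h₁ : IsSlitLine a t d b₁)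
    (h₂ : IsSlitLine a t d b₂) (hr : rk (b₁ ⊓ b₂) = rk a + 1) (hl : IsSlitLine a t d l) :
    (rk a + 1 ≤ rk (l ⊓ b₁) ∧ rk a + 1 ≤ rk (l ⊓ b₂) ∧ ∀ m, IsSlitLine a t d m →
        rk a + 1 ≤ rk (m ⊓ b₁) → rk a + 1 ≤ rk (m ⊓ b₂) → rk a + 1 ≤ rk (m ⊓ l)) ↔
      b₁ ⊓ b₂ ≤ l ∧ l ≤ b₁ ⊔ b₂ := by
  have hau : a ≤ b₁ ⊓ b₂ := le_inf h₁.1 h₂.1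
  have hsup := rk_sup_add_inf b₁ b₂
  have h1r := h₁.2.2.1
  have h2r := h₂.2.2.1
  have hlr := hl.2.2.1
  have hu : b₁ ⊓ b₂ ≤ b₁ ⊔ b₂ := inf_le_left.trans le_sup_left
  constructor
  · rintro ⟨hl1, hl2, hall⟩
    have hor := inf_le_or_le_sup hlr hr hl1 hl2
    have h1 : b₁ ⊓ b₂ ≤ l := by
      by_contra hcon
      have hly := hor.resolve_left hcon
      obtain ⟨m, hm, hum, hmy⟩ := exists_slitLine_not_le (t := t) (d := d) hau hr hu
        (inf_le_left.trans h₁.2.1) (fun h => by have := rk_mono h; omega)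
        (fun h => h₁.2.2.2 (h₁.2.1.trans h))
      refine not_meet hum hu hr hm.2.2.1 hmy hly hcon (hall m hm ?_ ?_)
      · exact hr ▸ rk_mono (le_inf hum inf_le_left)
      · exact hr ▸ rk_mono (le_inf hum inf_le_right)
    refine ⟨h1, ?_⟩
    by_contra hcon
    obtain ⟨m, hm, hmy, hum⟩ := exists_slitLine_transversal h₁ h₂ hr
    refine not_meet h1 hu hr hlr hcon hmy hum ?_
    rw [inf_comm]
    have hmr := hm.2.2.1
    have e1 := rk_le_rk_inf hmy (le_sup_left : b₁ ≤ b₁ ⊔ b₂)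
    have e2 := rk_le_rk_inf hmy (le_sup_right : b₂ ≤ b₁ ⊔ b₂)
    exact hall m hm (by omega) (by omega)
  · rintro ⟨hul, hly⟩
    have e1 := rk_le_rk_inf hly (le_sup_left : b₁ ≤ b₁ ⊔ b₂)
    have e2 := rk_le_rk_inf hly (le_sup_right : b₂ ≤ b₁ ⊔ b₂)
    refine ⟨by omega, by omega, fun m hm hm1 hm2 => ?_⟩
    rcases inf_le_or_le_sup hm.2.2.1 hr hm1 hm2 with h | h
    · exact hr ▸ rk_mono (le_inf h hul)
    · have e3 := rk_le_rk_inf h hly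
      have := hm.2.2.1
      omega

/-- In a slit space of rank at least four, two intersecting lines have two common transversals that
do not meet each other. -/
theorem exists_not_meet (ht : rk a + 4 ≤ rk t) (h₁ : IsSlitLine a t d b₁)
    (h₂ : IsSlitLine a t d b₂) (hr : rk (b₁ ⊓ b₂) = rk a + 1) :
    ∃ m n, IsSlitLine a t d m ∧ IsSlitLine a t d n ∧
      rk a + 1 ≤ rk (m ⊓ b₁) ∧ rk a + 1 ≤ rk (m ⊓ b₂) ∧
      rk a + 1 ≤ rk (n ⊓ b₁) ∧ rk a + 1 ≤ rk (n ⊓ b₂) ∧ ¬ rk a + 1 ≤ rk (m ⊓ n) := by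
  have hau : a ≤ b₁ ⊓ b₂ := le_inf h₁.1 h₂.1
  have hsup := rk_sup_add_inf b₁ b₂
  have h1r := h₁.2.2.1
  have h2r := h₂.2.2.1
  have hu : b₁ ⊓ b₂ ≤ b₁ ⊔ b₂ := inf_le_left.trans le_sup_left
  obtain ⟨m, hm, hum, hmy⟩ := exists_slitLine_not_le (t := t) (d := d) hau hr hu
    (inf_le_left.trans h₁.2.1) (fun h => by have := rk_mono h; omega)
    (fun h => h₁.2.2.2 (h₁.2.1.trans h))
  obtain ⟨n, hn, hny, hun⟩ := exists_slitLine_transversal h₁ h₂ hr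
  have hnr := hn.2.2.1
  have e1 := rk_le_rk_inf hny (le_sup_left : b₁ ≤ b₁ ⊔ b₂)
  have e2 := rk_le_rk_inf hny (le_sup_right : b₂ ≤ b₁ ⊔ b₂)
  exact ⟨m, n, hm, hn, hr ▸ rk_mono (le_inf hum inf_le_left),
    hr ▸ rk_mono (le_inf hum inf_le_right), by omega, by omega,
    not_meet hum hu hr hm.2.2.1 hmy hny hun⟩

/-- Two lines of a slit space have two common transversals, which meet each other; all the
intersection points can be chosen off the slit. The two lines may be equal if the rank is at least
three. -/
theorem exists_two_transversals (h₁ : IsSlitLine a t d b₁) (h₂ : IsSlitLine a t d b₂)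
    (h : b₁ ≠ b₂ ∨ rk a + 3 ≤ rk t) :
    ∃ m n, IsSlitLine a t d m ∧ IsSlitLine a t d n ∧ m ≠ n ∧
      (∃ u, a ≤ u ∧ rk u = rk a + 1 ∧ u ≤ m ∧ u ≤ n ∧ ¬ u ≤ d) ∧
      (∃ u, a ≤ u ∧ rk u = rk a + 1 ∧ u ≤ b₁ ∧ u ≤ m ∧ ¬ u ≤ d) ∧
      (∃ u, a ≤ u ∧ rk u = rk a + 1 ∧ u ≤ b₁ ∧ u ≤ n ∧ ¬ u ≤ d) ∧
      (∃ u, a ≤ u ∧ rk u = rk a + 1 ∧ u ≤ b₂ ∧ u ≤ m ∧ ¬ u ≤ d) ∧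
      (∃ u, a ≤ u ∧ rk u = rk a + 1 ∧ u ≤ b₂ ∧ u ≤ n ∧ ¬ u ≤ d) := by
  obtain ⟨h1a, h1t, h1r, h1d⟩ := h₁
  obtain ⟨h2a, h2t, h2r, h2d⟩ := h₂
  -- A point `q` off the second line and two points of the second line span the transversals.
  have key : ∀ q : Λ, a ≤ q → q ≤ t → rk q = rk a + 1 → ¬ q ≤ b₂ → ¬ q ≤ d →
      ∃ m n, IsSlitLine a t d m ∧ IsSlitLine a t d n ∧ m ≠ n ∧ q ≤ m ∧ q ≤ n ∧
      (∃ u, a ≤ u ∧ rk u = rk a + 1 ∧ u ≤ b₂ ∧ u ≤ m ∧ ¬ u ≤ d) ∧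
      (∃ u, a ≤ u ∧ rk u = rk a + 1 ∧ u ≤ b₂ ∧ u ≤ n ∧ ¬ u ≤ d) := by
    intro q hq hqt hqr hqb hqd
    have n2 : ¬ b₂ ≤ a := fun h => by have := rk_mono h; omega
    obtain ⟨p, hp, hpb, hpr, -, hpd⟩ := exists_atom h2a le_rfl n2 h2d
    have n3 : ¬ b₂ ≤ p := fun h => by have := rk_mono h; omega
    obtain ⟨p', hp', hpb', hpr', hpp, hpd'⟩ := exists_atom h2a hp n3 h2d
    have ne1 : q ≠ p := fun h => hqb (h ▸ hpb)
    have ne2 : q ≠ p' := fun h => hqb (h ▸ hpb')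
    have r1 := rk_sup_of_ne hq hp hqr hpr ne1
    have r2 := rk_sup_of_ne hq hp' hqr hpr' ne2
    refine ⟨q ⊔ p, q ⊔ p', ⟨hq.trans le_sup_left, sup_le hqt (hpb.trans h2t), r1,
      fun h => hqd (le_sup_left.trans h)⟩, ⟨hq.trans le_sup_left, sup_le hqt (hpb'.trans h2t), r2,
      fun h => hqd (le_sup_left.trans h)⟩, fun h => ?_, le_sup_left, le_sup_left,
      ⟨p, hp, hpr, hpb, le_sup_right, hpd⟩, ⟨p', hp', hpr', hpb', le_sup_right, hpd'⟩⟩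
    have hne : p ≠ p' := fun h => hpp h.ge
    have e1 := eq_sup_of_ne hp hp' hpr hpr' hne hpb hpb' h2r
    have e2 := eq_sup_of_ne hp hp' hpr hpr' hne le_sup_right (h ▸ le_sup_right) r1
    exact hqb (le_sup_left.trans (e2.symm.trans e1).le)
  by_cases hb : b₁ = b₂
  · subst hb
    have ht := h.resolve_left (fun h => h rfl)
    obtain ⟨q, hq, hqt, hqr, hqb, hqd⟩ := exists_atom (h1a.trans h1t) h1a
      (fun h => by have := rk_mono h; omega) (fun h => h1d (h1t.trans h))
    obtain ⟨m, n, hm, hn, hmn, hqm, hqn, hu, hv⟩ := key q hq hqt hqr hqb hqd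
    exact ⟨m, n, hm, hn, hmn, ⟨q, hq, hqr, hqm, hqn, hqd⟩, hu, hv, hu, hv⟩
  · have n1 : ¬ b₁ ≤ b₂ := fun h => hb (eq_of_le_of_rk_le h (by omega))
    obtain ⟨q, hq, hqb1, hqr, hqb, hqd⟩ := exists_atom h1a h2a n1 h1d
    obtain ⟨m, n, hm, hn, hmn, hqm, hqn, hu, hv⟩ := key q hq (hqb1.trans h1t) hqr hqb hqd
    exact ⟨m, n, hm, hn, hmn, ⟨q, hq, hqr, hqm, hqn, hqd⟩, ⟨q, hq, hqr, hqb1, hqm, hqd⟩,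
      ⟨q, hq, hqr, hqb1, hqn, hqd⟩, hu, hv⟩

/-- The Veblen axiom off the slit: if `b₁, b₂, b₃, b₄` pairwise meet, if the pencils of `b₁, b₃` and
of `b₂, b₄` share a line and if `b₁ ⊓ b₂` is not in the slit, then the pencils of `b₁, b₂` and of
`b₃, b₄` share a line. -/
theorem exists_slitLine_of_veblen {b₁ b₂ b₃ b₄ o : Λ}
    (h₁ : IsSlitLine a t d b₁) (h₂ : IsSlitLine a t d b₂) (h₃ : IsSlitLine a t d b₃)
    (h₄ : IsSlitLine a t d b₄) (ho : IsSlitLine a t d o)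
    (h12 : rk (b₁ ⊓ b₂) = rk a + 1) (h34 : rk (b₃ ⊓ b₄) = rk a + 1)
    (h13 : rk (b₁ ⊓ b₃) = rk a + 1) (h24 : rk (b₂ ⊓ b₄) = rk a + 1)
    (h32 : rk a + 1 ≤ rk (b₃ ⊓ b₂)) (h41 : rk a + 1 ≤ rk (b₄ ⊓ b₁))
    (ho13 : o ≤ b₁ ⊔ b₃) (ho24 : o ≤ b₂ ⊔ b₄) (hd : ¬ b₁ ⊓ b₂ ≤ d) :
    ∃ l, IsSlitLine a t d l ∧ b₁ ⊓ b₂ ≤ l ∧ l ≤ b₁ ⊔ b₂ ∧ b₃ ⊓ b₄ ≤ l ∧ l ≤ b₃ ⊔ b₄ := by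
  have r1 := h₁.2.2.1
  have r2 := h₂.2.2.1
  have r3 := h₃.2.2.1
  have r4 := h₄.2.2.1
  have ro := ho.2.2.1
  have s12 := rk_sup_add_inf b₁ b₂
  have s34 := rk_sup_add_inf b₃ b₄
  have s13 := rk_sup_add_inf b₁ b₃
  have s24 := rk_sup_add_inf b₂ b₄
  have hau : a ≤ b₁ ⊓ b₂ := le_inf h₁.1 h₂.1
  have hav : a ≤ b₃ ⊓ b₄ := le_inf h₃.1 h₄.1
  have hb3 := inf_le_or_le_sup r3 h12 (by rw [inf_comm]; omega) h32
  have hb4 := inf_le_or_le_sup r4 h12 h41 (by rw [inf_comm]; omega)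
  have huy : b₁ ⊓ b₂ ≤ b₁ ⊔ b₂ := inf_le_left.trans le_sup_left
  by_cases hu3 : b₁ ⊓ b₂ ≤ b₃
  · by_cases hu4 : b₁ ⊓ b₂ ≤ b₄
    · have huv : b₁ ⊓ b₂ = b₃ ⊓ b₄ := eq_of_le_of_rk_le (le_inf hu3 hu4) (by omega)
      -- The four lines span a solid, in which the two planes through `b₁ ⊓ b₂` meet in a line.
      have e1 := rk_mono (le_inf ho13 ho24)
      have e2 := rk_sup_add_inf (b₁ ⊔ b₃) (b₂ ⊔ b₄)
      have e3 := rk_sup_add_inf (b₁ ⊔ b₂) (b₃ ⊔ b₄)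
      have e4 : (b₁ ⊔ b₂) ⊔ (b₃ ⊔ b₄) = (b₁ ⊔ b₃) ⊔ (b₂ ⊔ b₄) := sup_sup_sup_comm _ _ _ _
      rw [e4] at e3
      have hu34 : b₁ ⊓ b₂ ≤ b₃ ⊔ b₄ := hu3.trans le_sup_left
      obtain ⟨l, hul, hl, hlr⟩ := exists_between (r := rk a + 2) (le_inf huy hu34)
        (by omega) (by omega)
      exact ⟨l, ⟨hau.trans hul, (hl.trans inf_le_left).trans (sup_le h₁.2.1 h₂.2.1), hlr,
        fun h => hd (hul.trans h)⟩, hul, hl.trans inf_le_left, huv ▸ hul, hl.trans inf_le_right⟩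
    · by_cases h3y : b₃ ≤ b₁ ⊔ b₂
      · exact ⟨b₃, h₃, hu3, h3y, inf_le_left, le_sup_left⟩
      · exact absurd h34.ge (not_meet hu3 huy h12 r3 h3y (hb4.resolve_left hu4) hu4)
  · have h3y := hb3.resolve_left hu3
    by_cases h4y : b₄ ≤ b₁ ⊔ b₂
    · have e : b₃ ⊔ b₄ = b₁ ⊔ b₂ := eq_of_le_of_rk_le (sup_le h3y h4y) (by omega)
      have hne : b₁ ⊓ b₂ ≠ b₃ ⊓ b₄ := fun h => hu3 (h ▸ inf_le_left)
      have hl := rk_sup_of_ne hau hav h12 h34 hne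
      have hvy : b₃ ⊓ b₄ ≤ b₁ ⊔ b₂ := inf_le_left.trans h3y
      exact ⟨(b₁ ⊓ b₂) ⊔ (b₃ ⊓ b₄), ⟨hau.trans le_sup_left,
        (sup_le huy hvy).trans (sup_le h₁.2.1 h₂.2.1), hl, fun h => hd (le_sup_left.trans h)⟩,
        le_sup_left, sup_le huy hvy, le_sup_right, e ▸ sup_le huy hvy⟩
    · refine absurd h34.ge ?_
      rw [inf_comm]
      exact not_meet (hb4.resolve_right h4y) huy h12 r4 h4y h3y hu3

/-- The Veblen axiom fails at a point `u` of a slit `d` that is not a single point: the two pencils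
in an affine plane with vertices on its line at infinity have no common line. -/
theorem exists_veblen_failure (h₁ : IsSlitLine a t d b₁) (hau : a ≤ u) (hu : rk u = rk a + 1)
    (hub : u ≤ b₁) (hud : u ≤ d) (hd : rk a + 2 ≤ rk d) (hdt : d ≤ t) :
    ∃ b₂ b₃ b₄ o y, IsSlitLine a t d b₂ ∧ IsSlitLine a t d b₃ ∧ IsSlitLine a t d b₄ ∧
      IsSlitLine a t d o ∧ (b₁ ≤ y ∧ b₂ ≤ y ∧ b₃ ≤ y ∧ b₄ ≤ y ∧ rk y = rk a + 3) ∧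
      (b₁ ≠ b₂ ∧ b₃ ≠ b₄ ∧ b₁ ≠ b₃ ∧ b₂ ≠ b₄) ∧ u ≤ b₂ ∧
      (b₁ ⊓ b₃ ≤ o ∧ o ≤ b₁ ⊔ b₃) ∧ (b₂ ⊓ b₄ ≤ o ∧ o ≤ b₂ ⊔ b₄) ∧
      ∀ l, IsSlitLine a t d l → b₁ ⊓ b₂ ≤ l → ¬ b₃ ⊓ b₄ ≤ l := by
  obtain ⟨h1a, h1t, h1r, h1d⟩ := h₁
  obtain ⟨e, hue, hed, her⟩ := exists_between (r := rk a + 2) hud (by omega) hd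
  have hae := hau.trans hue
  have heu : ¬ e ≤ u := fun h => by have := rk_mono h; omega
  obtain ⟨v, hv, hve, hvr, hvu, -⟩ := exists_atom hae hau heu heu
  have huv : u ≠ v := fun h => hvu h.ge
  have e_eq : u ⊔ v = e := eq_sup_of_ne hau hv hu hvr huv hue hve her
  have hvb : ¬ v ≤ b₁ := fun h => h1d
    ((eq_sup_of_ne hau hv hu hvr huv hub h h1r).symm.trans e_eq |>.le.trans hed)
  -- the plane `y` spanned by `b₁` and by the line `e` of the slit
  have hb1e : ¬ b₁ ≤ e := fun h => h1d (h.trans hed)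
  have hinf : b₁ ⊓ e = u := by
    have := rk_inf_lt hb1e
    exact (eq_of_le_of_rk_le (le_inf hub hue) (by omega)).symm
  have hy := rk_sup_add_inf b₁ e
  rw [hinf] at hy
  have hyr : rk (b₁ ⊔ e) = rk a + 3 := by omega
  have hyt : b₁ ⊔ e ≤ t := sup_le h1t (hed.trans hdt)
  have hyn : ∀ z : Λ, rk z = rk a + 2 → ¬ b₁ ⊔ e ≤ z := fun z hz h => by
    have := rk_mono h; omega
  have off : ∀ z : Λ, z ≤ b₁ ⊔ e → rk z = rk a + 2 → z ≠ e → ¬ z ≤ d := by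
    intro z hz hzr hze h
    have hs : rk (z ⊔ e) = rk a + 3 := by
      have h1 := rk_mono (sup_le hz (le_sup_right : e ≤ b₁ ⊔ e))
      by_contra hcon
      have h2 : e = z ⊔ e := eq_of_le_of_rk_le le_sup_right (by
        have := rk_mono (le_sup_right : e ≤ z ⊔ e); omega)
      exact hze (eq_of_le_of_rk_le (h2 ▸ le_sup_left) (by omega))
    have h3 : z ⊔ e = b₁ ⊔ e := eq_of_le_of_rk_le (sup_le hz le_sup_right) (by omega)
    exact h1d (le_sup_left.trans (h3.ge.trans (sup_le h hed)))
  have hb1u : ¬ b₁ ≤ u := fun h => by have := rk_mono h; omega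
  obtain ⟨p, hp, hpb, hpr, hpu, -⟩ := exists_atom h1a hau hb1u hb1u
  have hpe : ¬ p ≤ e := fun h => hpu (hinf ▸ le_inf hpb h)
  have hpd : ¬ p ≤ d := fun h => by
    have h3 := eq_sup_of_ne hau hp hu hpr (fun h => hpu h.ge) hub hpb h1r
    exact h1d (h3 ▸ sup_le hud h)
  have hvp : v ≠ p := fun h => hpe (h ▸ hve)
  have h3r := rk_sup_of_ne hv hp hvr hpr hvp
  have h3e : v ⊔ p ≠ e := fun h => hpe (h ▸ le_sup_right)
  have h3y : v ⊔ p ≤ b₁ ⊔ e := sup_le (hve.trans le_sup_right) (hpb.trans le_sup_left)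
  obtain ⟨b₂, hub2, h2y, h2r, h21, h2e⟩ := exists_atom (hub.trans le_sup_left) hub (hyn b₁ h1r)
    (hyn e her)
  obtain ⟨b₄, hvb4, h4y, h4r, h43, h4e⟩ := exists_atom (hve.trans le_sup_right)
    (le_sup_left : v ≤ v ⊔ p) (hyn _ h3r) (hyn e her)
  rw [hu] at h2r
  rw [hvr] at h4r
  have slit : ∀ z : Λ, a ≤ z → z ≤ b₁ ⊔ e → rk z = rk a + 2 → z ≠ e → IsSlitLine a t d z :=
    fun z hz hzy hzr hze => ⟨hz, hzy.trans hyt, hzr, off z hzy hzr hze⟩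
  have hvb2 : ¬ v ≤ b₂ := fun h => h2e
    ((eq_sup_of_ne hau hv hu hvr huv hub2 h h2r).symm.trans e_eq).le
  have ne24 : b₂ ≠ b₄ := fun h => hvb2 (h ▸ hvb4)
  have ne13 : b₁ ≠ v ⊔ p := fun h => hvb (h ▸ le_sup_left)
  have ne12 : b₁ ≠ b₂ := fun h => h21 h.ge
  have ne34 : v ⊔ p ≠ b₄ := fun h => h43 h.ge
  have sup_y : ∀ x z : Λ, x ≤ b₁ ⊔ e → z ≤ b₁ ⊔ e → rk x = rk a + 2 → rk z = rk a + 2 → x ≠ z →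
      x ⊔ z = b₁ ⊔ e ∧ rk (x ⊓ z) = rk a + 1 := by
    intro x z hx hz hxr hzr hxz
    have h1 := rk_mono (sup_le hx hz)
    have h2 := rk_sup_add_inf x z
    have h3 : ¬ x ≤ z := fun h => hxz (eq_of_le_of_rk_le h (by omega))
    have h4 := rk_inf_lt h3
    exact ⟨eq_of_le_of_rk_le (sup_le hx hz) (by omega), by omega⟩
  obtain ⟨s24, i24⟩ := sup_y b₂ b₄ h2y h4y h2r h4r ne24
  obtain ⟨s13, i13⟩ := sup_y b₁ (v ⊔ p) le_sup_left h3y h1r h3r ne13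
  obtain ⟨-, i12⟩ := sup_y b₁ b₂ le_sup_left h2y h1r h2r ne12
  obtain ⟨-, i34⟩ := sup_y (v ⊔ p) b₄ h3y h4y h3r h4r ne34
  have a2 := hau.trans hub2
  have a4 := hv.trans hvb4
  have eu : b₁ ⊓ b₂ = u := (eq_of_le_of_rk_le (le_inf hub hub2) (by omega)).symm
  have ev : (v ⊔ p) ⊓ b₄ = v := (eq_of_le_of_rk_le (le_inf le_sup_left hvb4) (by omega)).symm
  have ep : b₁ ⊓ (v ⊔ p) = p := (eq_of_le_of_rk_le (le_inf hpb le_sup_right) (by omega)).symm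
  have hpq : p ≠ b₂ ⊓ b₄ := fun h => h21 (by
    have := eq_sup_of_ne hau hp hu hpr (fun h => hpu h.ge) hub2 (h ▸ inf_le_left) h2r
    exact this ▸ sup_le hub hpb)
  have hor := rk_sup_of_ne hp (le_inf a2 a4) hpr i24 hpq
  have hoy : p ⊔ b₂ ⊓ b₄ ≤ b₁ ⊔ e := sup_le (hpb.trans le_sup_left) (inf_le_left.trans h2y)
  refine ⟨b₂, v ⊔ p, b₄, p ⊔ b₂ ⊓ b₄, b₁ ⊔ e, slit b₂ a2 h2y h2r (fun h => h2e h.le),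
    slit _ (hv.trans le_sup_left) h3y h3r h3e, slit _ a4 h4y h4r (fun h => h4e h.le),
    slit _ (hp.trans le_sup_left) hoy hor (fun h => hpe (h ▸ le_sup_left)),
    ⟨le_sup_left, h2y, h3y, h4y, hyr⟩, ⟨ne12, ne34, ne13, ne24⟩, hub2,
    ⟨ep.le.trans le_sup_left, s13 ▸ hoy⟩, ⟨le_sup_right, s24 ▸ hoy⟩, fun l hl hl1 hl2 => ?_⟩
  rw [eu] at hl1
  rw [ev] at hl2
  have := eq_sup_of_ne hau hv hu hvr huv hl1 hl2 hl.2.2.1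
  exact hl.2.2.2 (by rw [← this, e_eq]; exact hed)

/-- An element of rank two over `a` is a line of the slit space as soon as it contains two points of
the slit space. -/
theorem isSlitLine_iff_exists_two (had : a ≤ d) (hab : a ≤ b) (hb : rk b = rk a + 2) :
    IsSlitLine a t d b ↔ ∃ u v, u ≠ v ∧
      (a ≤ u ∧ u ≤ b ∧ rk u = rk a + 1 ∧ u ≤ t ∧ ¬ u ≤ d) ∧
      (a ≤ v ∧ v ≤ b ∧ rk v = rk a + 1 ∧ v ≤ t ∧ ¬ v ≤ d) := by
  constructor
  · rintro ⟨-, hbt, -, hbd⟩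
    obtain ⟨p, hp, hpb, hpr, hpd, -⟩ := exists_atom hab had hbd hbd
    obtain ⟨q, hq, hqb, hqr, hqp, hqd⟩ := exists_atom hab hp
      (fun h => by have := rk_mono h; omega) hbd
    exact ⟨p, q, fun h => hqp h.ge, ⟨hp, hpb, hpr, hpb.trans hbt, hpd⟩,
      ⟨hq, hqb, hqr, hqb.trans hbt, hqd⟩⟩
  · rintro ⟨u, v, hne, ⟨hu, hub, hur, hut, hud⟩, ⟨hv, hvb, hvr, hvt, -⟩⟩
    refine ⟨hab, ?_, hb, fun h => hud (hub.trans h)⟩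
    rw [← eq_sup_of_ne hu hv hur hvr hne hub hvb hb]
    exact sup_le hut hvt

/-- In a plane of a slit space, every point is on two lines of the slit space. -/
theorem exists_two_slitLines (hau : a ≤ u) (hu : rk u = rk a + 1) (huy : u ≤ y)
    (hy : rk y = rk a + 3) (hyt : y ≤ t) (hyd : ¬ y ≤ d) :
    ∃ b₁ b₂, b₁ ≠ b₂ ∧ (IsSlitLine a t d b₁ ∧ u ≤ b₁ ∧ b₁ ≤ y) ∧
      (IsSlitLine a t d b₂ ∧ u ≤ b₂ ∧ b₂ ≤ y) := by
  obtain ⟨b, hb, hby, hbr, -, hbd⟩ := exists_atom huy le_rfl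
    (fun h => by have := rk_mono h; omega) hyd
  obtain ⟨c, hc, hcy, hcr, hcb, hcd⟩ := exists_atom huy hb
    (fun h => by have := rk_mono h; omega) hyd
  exact ⟨b, c, fun h => hcb h.ge, ⟨⟨hau.trans hb, hby.trans hyt, by omega, hbd⟩, hb, hby⟩,
    ⟨⟨hau.trans hc, hcy.trans hyt, by omega, hcd⟩, hc, hcy⟩⟩

end RankedLattice

/-! ### Lattices of subspaces -/

section Submodule

variable {K V : Type*} [DivisionRing K] [AddCommGroup V] [Module K V]

theorem exists_mem_notMem_notMem {b x y : Submodule K V} (hx : ¬ b ≤ x) (hy : ¬ b ≤ y) :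
    ∃ v ∈ b, v ∉ x ∧ v ∉ y := by
  obtain ⟨v, hv, hvx⟩ := SetLike.not_le_iff_exists.1 hx
  obtain ⟨w, hw, hwy⟩ := SetLike.not_le_iff_exists.1 hy
  by_cases hvy : v ∈ y
  · by_cases hwx : w ∈ x
    · exact ⟨v + w, b.add_mem hv hw, fun h => hvx ((x.add_mem_iff_left hwx).1 h),
        fun h => hwy ((y.add_mem_iff_right hvy).1 h)⟩
    · exact ⟨w, hw, hwx, hwy⟩
  · exact ⟨v, hv, hvx, hvy⟩

variable [FiniteDimensional K V]

theorem finrank_sup_span_singleton {a : Submodule K V} {v : V} (hv : v ∉ a) :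
    finrank K (a ⊔ K ∙ v : Submodule K V) = finrank K a + 1 := by
  have h0 : v ≠ 0 := fun h => hv (h ▸ a.zero_mem)
  have h1 := Submodule.finrank_sup_add_finrank_inf_eq a (K ∙ v)
  have h2 : a ⊓ (K ∙ v) = ⊥ := by
    refine (Submodule.eq_bot_iff _).2 fun x hx => ?_
    obtain ⟨r, rfl⟩ := Submodule.mem_span_singleton.1 hx.2
    by_cases hr : r = 0
    · simp [hr]
    · exact absurd ((Submodule.smul_mem_iff _ hr).1 hx.1) hv
  rw [h2, finrank_bot, finrank_span_singleton h0] at h1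
  exact h1

/-- A subspace of `c` that contains `e` and is a hyperplane of `c` can be chosen off a vector of
`c` that is not in `e`. -/
theorem exists_hyperplane_notMem {e c : Submodule K V} (hec : e ≤ c) {v : V} (hv : v ∈ c)
    (hve : v ∉ e) : ∃ p : Submodule K V, e ≤ p ∧ p ≤ c ∧ finrank K p + 1 = finrank K c ∧ v ∉ p := by
  obtain ⟨q, hq⟩ := exists_isCompl (e ⊔ K ∙ v : Submodule K V)
  have hsc : e ⊔ K ∙ v ≤ c := sup_le hec ((Submodule.span_singleton_le_iff_mem _ _).2 hv)
  have h1 : (e ⊔ q ⊓ c) ⊓ (e ⊔ K ∙ v) = e := by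
    rw [sup_inf_assoc_of_le _ (le_sup_left : e ≤ e ⊔ K ∙ v), inf_right_comm,
      inf_comm q, hq.inf_eq_bot, bot_inf_eq, sup_bot_eq]
  have hvp : v ∉ e ⊔ q ⊓ c := fun h => hve (h1 ▸ ⟨h,
    (le_sup_right : (K ∙ v) ≤ e ⊔ K ∙ v) (Submodule.mem_span_singleton_self v)⟩)
  have h2 : (e ⊔ q ⊓ c) ⊔ K ∙ v = c := by
    rw [sup_right_comm, ← sup_inf_assoc_of_le _ hsc, hq.sup_eq_top, top_inf_eq]
  refine ⟨e ⊔ q ⊓ c, le_sup_left, sup_le hec inf_le_right, ?_, hvp⟩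
  rw [← finrank_sup_span_singleton hvp, h2]

/-- A hyperplane of `c` through `e` that contains neither of two given subspaces. -/
theorem exists_hyperplane_not_le {e c x y : Submodule K V} (hec : e ≤ c) (hxc : x ≤ c)
    (hx : ¬ x ≤ e) (hy : ¬ y ≤ e) :
    ∃ p : Submodule K V, e ≤ p ∧ p ≤ c ∧ finrank K p + 1 = finrank K c ∧ ¬ x ≤ p ∧ ¬ y ≤ p := by
  obtain ⟨v, hv, hve⟩ := SetLike.not_le_iff_exists.1 hx
  by_cases hyc : y ≤ c
  · obtain ⟨w, hw, hwe⟩ := SetLike.not_le_iff_exists.1 hy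
    -- It suffices to avoid `v` and `w`; a hyperplane through `v - w` contains both or neither.
    by_cases hvw : v ∈ e ⊔ K ∙ (v - w)
    · obtain ⟨p, hep, hpc, hp, hvp⟩ := exists_hyperplane_notMem hec (hxc hv) hve
      refine ⟨p, hep, hpc, hp, fun h => hvp (h hv), fun h => ?_⟩
      have hwp := h hw
      obtain ⟨z, hz, s, hs, hzs⟩ := Submodule.mem_sup.1 hvw
      obtain ⟨r, rfl⟩ := Submodule.mem_span_singleton.1 hs
      have h3 : (1 - r) • v ∈ p := by
        have : (1 - r) • v = z - r • w := by
          rw [sub_smul, one_smul, smul_sub] at *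
          nth_rewrite 1 [← hzs]
          abel
        rw [this]
        exact p.sub_mem (hep hz) (p.smul_mem r hwp)
      by_cases hr : 1 - r = 0
      · have hr1 : r = 1 := (sub_eq_zero.1 hr).symm
        rw [hr1, one_smul] at hzs
        have : w = z := by
          have h5 : z = v - (v - w) := eq_sub_of_add_eq hzs
          rw [h5]; abel
        exact hwe (this ▸ hz)
      · exact hvp ((Submodule.smul_mem_iff _ hr).1 h3)
    · have hvwc : v - w ∈ c := c.sub_mem (hxc hv) (hyc hw)
      obtain ⟨p, hep, hpc, hp, hvp⟩ := exists_hyperplane_notMem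
        (sup_le hec ((Submodule.span_singleton_le_iff_mem _ _).2 hvwc)) (hxc hv) hvw
      have hvwp : v - w ∈ p :=
        hep ((le_sup_right : (K ∙ (v - w)) ≤ _) (Submodule.mem_span_singleton_self _))
      exact ⟨p, le_sup_left.trans hep, hpc, hp, fun h => hvp (h hv),
        fun h => hvp (by simpa using p.add_mem hvwp (h hw))⟩
  · obtain ⟨p, hep, hpc, hp, hvp⟩ := exists_hyperplane_notMem hec (hxc hv) hve
    exact ⟨p, hep, hpc, hp, fun h => hvp (h hv), fun h => hyc (h.trans hpc)⟩

noncomputable instance : RankedLattice (Submodule K V) where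
  rk U := finrank K U
  rk_lt h := Submodule.finrank_lt_finrank_of_lt h
  rk_sup_add_inf a b := Submodule.finrank_sup_add_finrank_inf_eq a b
  exists_atom {a b x y} hab hax hx hy := by
    obtain ⟨v, hv, hvx, hvy⟩ := exists_mem_notMem_notMem hx hy
    have hm : v ∈ a ⊔ K ∙ v :=
      (le_sup_right : (K ∙ v) ≤ a ⊔ K ∙ v) (Submodule.mem_span_singleton_self v)
    exact ⟨a ⊔ K ∙ v, le_sup_left, sup_le hab ((Submodule.span_singleton_le_iff_mem _ _).2 hv),
      finrank_sup_span_singleton fun h => hvx (hax h), fun h => hvx (h hm), fun h => hvy (h hm)⟩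

open OrderDual in
noncomputable instance : RankedLattice (Submodule K V)ᵒᵈ where
  rk U := finrank K V - finrank K (ofDual U : Submodule K V)
  rk_lt {a b} h := by
    have := Submodule.finrank_lt_finrank_of_lt (ofDual_lt_ofDual.2 h)
    have := Submodule.finrank_le (ofDual a : Submodule K V)
    omega
  rk_sup_add_inf a b := by
    have h : finrank K (ofDual (a ⊓ b) : Submodule K V) +
        finrank K (ofDual (a ⊔ b) : Submodule K V) = _ :=
      Submodule.finrank_sup_add_finrank_inf_eq (ofDual a : Submodule K V) (ofDual b : Submodule K V)
    have := Submodule.finrank_le (ofDual a : Submodule K V)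
    have := Submodule.finrank_le (ofDual b : Submodule K V)
    have := Submodule.finrank_le (ofDual (a ⊔ b) : Submodule K V)
    have := Submodule.finrank_le (ofDual (a ⊓ b) : Submodule K V)
    omega
  exists_atom {a b x y} hab hax hx hy := by
    obtain ⟨p, hbp, hpa, hp, hxp, hyp⟩ := exists_hyperplane_not_le (e := ofDual b) (c := ofDual a)
      (x := ofDual x) (y := ofDual y) hab hax hx hy
    refine ⟨toDual p, hpa, hbp, ?_, hxp, hyp⟩
    have := Submodule.finrank_le (ofDual a : Submodule K V)
    rw [ofDual_toDual]
    omega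

open RankedLattice OrderDual

theorem rk_eq (U : Submodule K V) : rk U = finrank K U := rfl

theorem rk_toDual (U : Submodule K V) : rk (toDual U) = finrank K V - finrank K U := rfl

end Submodule

/-! ### Closure properties of first-order definability -/

section Definability

variable {X : Type*} (R : X → X → Prop)

/-- A property of valuations `v : α → X` is definable if it is the realization of a first-order
formula, with free variables in `α`, of the structure `⟨X, R⟩`. -/
def IsDef {α : Type} (q : (α → X) → Prop) : Prop :=
  ∃ φ : binLang.Formula α, ∀ v,
    @FirstOrder.Language.Formula.Realize _ X (binStructure R) _ φ v ↔ q v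

/-- A binary relation on `X` that is definable in `⟨X, R⟩`. -/
def IsDef₂ (p : X → X → Prop) : Prop := IsDef R fun v : Fin 2 → X => p (v 0) (v 1)

/-- A ternary relation on `X` that is definable in `⟨X, R⟩`. -/
def IsDef₃ (p : X → X → X → Prop) : Prop := IsDef R fun v : Fin 3 → X => p (v 0) (v 1) (v 2)

/-- A quaternary relation on `X` that is definable in `⟨X, R⟩`. -/
def IsDef₄ (p : X → X → X → X → Prop) : Prop :=
  IsDef R fun v : Fin 4 → X => p (v 0) (v 1) (v 2) (v 3)

variable {R} {α : Type}

theorem isDef₂_self : IsDef₂ R R := by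
  let := binStructure R
  exact ⟨FirstOrder.Language.Relations.formula₂ (L := binLang) BinSymb.rel (.var 0) (.var 1),
    fun v => FirstOrder.Language.Formula.realize_rel₂⟩

theorem IsDef.eq (i j : α) : IsDef R fun v => v i = v j := by
  let := binStructure R
  exact ⟨(FirstOrder.Language.Term.var i).equal (.var j),
    fun v => FirstOrder.Language.Formula.realize_equal⟩

theorem IsDef.not {q : (α → X) → Prop} (h : IsDef R q) : IsDef R fun v => ¬ q v := by
  let := binStructure R
  obtain ⟨φ, hφ⟩ := h
  exact ⟨φ.not, fun v => FirstOrder.Language.Formula.realize_not.trans (not_congr (hφ v))⟩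

theorem IsDef.and {q q' : (α → X) → Prop} (h : IsDef R q) (h' : IsDef R q') :
    IsDef R fun v => q v ∧ q' v := by
  let := binStructure R
  obtain ⟨φ, hφ⟩ := h
  obtain ⟨ψ, hψ⟩ := h'
  exact ⟨φ ⊓ ψ, fun v => FirstOrder.Language.Formula.realize_inf.trans (and_congr (hφ v) (hψ v))⟩

theorem IsDef.congr {q q' : (α → X) → Prop} (h : IsDef R q) (hq : ∀ v, q v ↔ q' v) : IsDef R q' :=
  let ⟨φ, hφ⟩ := h
  ⟨φ, fun v => (hφ v).trans (hq v)⟩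

theorem IsDef.or {q q' : (α → X) → Prop} (h : IsDef R q) (h' : IsDef R q') :
    IsDef R fun v => q v ∨ q' v :=
  (h.not.and h'.not).not.congr fun _ => by tauto

theorem IsDef.imp {q q' : (α → X) → Prop} (h : IsDef R q) (h' : IsDef R q') :
    IsDef R fun v => q v → q' v :=
  (h.and h'.not).not.congr fun _ => by tauto

theorem IsDef.ex {p : (α → X) → X → Prop}
    (h : IsDef R fun v : α ⊕ Unit → X => p (fun i => v (.inl i)) (v (.inr ()))) :
    IsDef R fun v => ∃ x, p v x := by
  let := binStructure R
  obtain ⟨φ, hφ⟩ := h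
  refine ⟨φ.iExs Unit, fun v => FirstOrder.Language.Formula.realize_iExs.trans ?_⟩
  exact ⟨fun ⟨i, hi⟩ => ⟨i (), (hφ _).1 hi⟩, fun ⟨x, hx⟩ => ⟨fun _ => x, (hφ _).2 hx⟩⟩

theorem IsDef.all {p : (α → X) → X → Prop}
    (h : IsDef R fun v : α ⊕ Unit → X => p (fun i => v (.inl i)) (v (.inr ()))) :
    IsDef R fun v => ∀ x, p v x :=
  (IsDef.ex (p := fun v x => ¬ p v x) h.not).not.congr fun _ => by simp

theorem IsDef.relabel {β : Type} {q : (β → X) → Prop} (h : IsDef R q) (f : β → α) :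
    IsDef R fun v => q (v ∘ f) := by
  let := binStructure R
  obtain ⟨φ, hφ⟩ := h
  exact ⟨φ.relabel f, fun v => FirstOrder.Language.Formula.realize_relabel.trans (hφ _)⟩

theorem IsDef₂.app {p : X → X → Prop} (h : IsDef₂ R p) (i j : α) :
    IsDef R fun v => p (v i) (v j) :=
  IsDef.relabel h ![i, j]

theorem IsDef₃.app {p : X → X → X → Prop} (h : IsDef₃ R p) (i j k : α) :
    IsDef R fun v => p (v i) (v j) (v k) :=
  IsDef.relabel h ![i, j, k]

theorem IsDef₄.app {p : X → X → X → X → Prop} (h : IsDef₄ R p) (i j k l : α) :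
    IsDef R fun v => p (v i) (v j) (v k) (v l) :=
  IsDef.relabel h ![i, j, k, l]

theorem IsDef.definableIn {r : ℕ} {q : (Fin r → X) → Prop} (h : IsDef R q) :
    DefinableIn R {v | q v} := by
  let := binStructure R
  obtain ⟨φ, hφ⟩ := h
  exact Set.empty_definable_iff.2 ⟨φ, Set.ext fun v => (hφ v).symm⟩

/-- A family of sets `{x | T x a b}`, where `(a, b)` runs through the pairs in the relation `D`, is
definable if `D` and `T` are. -/
theorem definableFamily_of_isDef {D : X → X → Prop} {T : X → X → X → Prop} (hD : IsDef₂ R D)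
    (hT : IsDef₃ R T) {F : Set (Set X)}
    (hF : ∀ p, p ∈ F ↔ ∃ a b, D a b ∧ ∀ x, x ∈ p ↔ T x a b) : DefinableFamily R F := by
  refine ⟨2, {v | D (v 0) (v 1)}, {v | T (v 0) (v 1) (v 2)}, hD.definableIn, hT.definableIn,
    Set.ext fun p => (hF p).trans ⟨?_, ?_⟩⟩
  · rintro ⟨a, b, hab, hp⟩
    exact ⟨![a, b], hab, Set.ext hp⟩
  · rintro ⟨v, hv, rfl⟩
    exact ⟨v 0, v 1, hv, fun x => Iff.rfl⟩

end Definability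

/-! ### Relations defined from coplanarity -/

section Formulas

variable {X : Type*} (δ : X → X → Prop)

/-- Two lines are related to both of two distinct related lines: the lines are in a common star or
in a common top. -/
def SameSheet (a b : X) : Prop :=
  ∃ n n', n ≠ n' ∧ δ n n' ∧ δ a n ∧ δ a n' ∧ δ b n ∧ δ b n'

/-- An induced four-cycle of `SameSheet`. -/
def Rect (a b c d : X) : Prop :=
  SameSheet δ a b ∧ SameSheet δ b c ∧ SameSheet δ c d ∧ SameSheet δ d a ∧
    ¬ SameSheet δ a c ∧ ¬ SameSheet δ b d

/-- Two lines have two common transversals that are not related to each other. -/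
def Thick (a b : X) : Prop := ∃ m n, δ m a ∧ δ m b ∧ δ n a ∧ δ n b ∧ ¬ δ m n

/-- The side `a, m₁` is common to two four-cycles, so that `l`, `a`, `b` all pass through the common
point of `a` and `m₁`. -/
def Concur (l a b : X) : Prop := ∃ m₁ m₂ m, Rect δ a b m₂ m₁ ∧ Rect δ a l m m₁

/-- The line `l` is in the pencil of the lines `a` and `b`. -/
def InPencil (l a b : X) : Prop :=
  (δ l a ∧ δ l b ∧ ∀ m, δ m a → δ m b → δ m l) ∧ (Thick δ a b ∨ l = a ∨ l = b ∨ Concur δ l a b)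

/-- A failure of the Veblen axiom, or of its dual, at the pencil of the lines `a` and `b`. -/
def VeblenFails (a b : X) : Prop :=
  ∃ c d o, (a ≠ b ∧ c ≠ d ∧ a ≠ c ∧ b ≠ d) ∧ (δ a b ∧ δ c d ∧ δ a c ∧ δ b d ∧ δ c b ∧ δ d a) ∧
    InPencil δ o a c ∧ InPencil δ o b d ∧ ¬ ∃ x, InPencil δ x a b ∧ InPencil δ x c d

/-- The Veblen axiom fails at the pencil of `a` and some `n` for which `a`, `b` and `n` are in a
four-cycle, so that the pencils of `a, b` and of `a, n` have the same vertex. -/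
def FailsAcross (a b : X) : Prop := ∃ n x, Rect δ a b x n ∧ VeblenFails δ a n

/-- The common point of the lines `a` and `b` is improper. The first case applies to the lines of a
star; lines of a top are first moved to a star by a four-cycle. -/
def Improper (a b : X) : Prop :=
  FailsAcross δ a b ∨ ∃ n x, Rect δ a b x n ∧ FailsAcross δ a n

/-- If `δ` is the relation `ρ`, this defines coplanarity: two lines are in `ρ` or consecutive in a
four-cycle. -/
def CoplanarFrom (a b : X) : Prop := δ a b ∨ ∃ c d, Rect δ a b c d

variable {R : X → X → Prop} {δ} (h : IsDef₂ R δ)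
include h

theorem IsDef₂.sameSheet : IsDef₂ R (SameSheet δ) :=
  .ex <| .ex <| (IsDef.eq _ _).not.and <| (h.app _ _).and <| (h.app _ _).and <| (h.app _ _).and <|
    (h.app _ _).and (h.app _ _)

theorem IsDef₂.rect : IsDef₄ R (Rect δ) :=
  have s := h.sameSheet
  (s.app _ _).and <| (s.app _ _).and <| (s.app _ _).and <| (s.app _ _).and <|
    (s.app _ _).not.and (s.app _ _).not

theorem IsDef₂.inPencil : IsDef₃ R (InPencil δ) :=
  have t := h.rect
  ((h.app _ _).and <| (h.app _ _).and <| .all <| (h.app _ _).imp <| (h.app _ _).imp (h.app _ _)).and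
    <| (IsDef.ex <| .ex <| (h.app _ _).and <| (h.app _ _).and <| (h.app _ _).and <|
      (h.app _ _).and (h.app _ _).not).or <| (IsDef.eq _ _).or <| (IsDef.eq _ _).or <|
      .ex <| .ex <| .ex <| (t.app _ _ _ _).and (t.app _ _ _ _)

theorem IsDef₂.veblenFails : IsDef₂ R (VeblenFails δ) :=
  have t := h.inPencil
  .ex <| .ex <| .ex <|
    ((IsDef.eq _ _).not.and <| (IsDef.eq _ _).not.and <| (IsDef.eq _ _).not.and
      (IsDef.eq _ _).not).and <|
    ((h.app _ _).and <| (h.app _ _).and <| (h.app _ _).and <| (h.app _ _).and <|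
      (h.app _ _).and (h.app _ _)).and <| (t.app _ _ _).and <| (t.app _ _ _).and <|
    (IsDef.ex <| (t.app _ _ _).and (t.app _ _ _)).not

theorem IsDef₂.failsAcross : IsDef₂ R (FailsAcross δ) :=
  .ex <| .ex <| (h.rect.app _ _ _ _).and (h.veblenFails.app _ _)

theorem IsDef₂.improper : IsDef₂ R (Improper δ) :=
  (h.failsAcross.app _ _).or <| .ex <| .ex <| (h.rect.app _ _ _ _).and (h.failsAcross.app _ _)

theorem IsDef₂.coplanarFrom : IsDef₂ R (CoplanarFrom δ) :=
  (h.app _ _).or <| .ex <| .ex <| h.rect.app _ _ _ _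

end Formulas

open RankedLattice OrderDual

/-! ### Stars and tops as slit spaces -/

section Sheets

/-- The lines in `S` form a slit space over `a` through the embedding `ℓ`, in which `adj` is the
relation of meeting, and `padj` holds for lines meeting off the slit. The last field says that a
line meeting two of them is one of them. -/
structure IsSheet {X Λ : Type*} [Lattice Λ] [RankedLattice Λ] (adj padj : X → X → Prop)
    (S : Set X) (ℓ : X → Λ) (a t d : Λ) : Prop where
  slit : ∀ l ∈ S, IsSlitLine a t d (ℓ l)
  inj : ∀ l ∈ S, ∀ m ∈ S, ℓ l = ℓ m → l = m
  surj : ∀ b, IsSlitLine a t d b → ∃ l ∈ S, ℓ l = b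
  le_top : d ≤ t
  adj_iff : ∀ l ∈ S, ∀ m ∈ S, adj l m ↔ rk a + 1 ≤ rk (ℓ l ⊓ ℓ m)
  padj_of : ∀ l ∈ S, ∀ m ∈ S,
    (∃ u, a ≤ u ∧ rk u = rk a + 1 ∧ u ≤ ℓ l ∧ u ≤ ℓ m ∧ ¬ u ≤ d) → padj l m
  symm : ∀ l m, adj l m → adj m l
  closed : ∀ l ∈ S, ∀ m ∈ S, l ≠ m → ∀ n, adj n l → adj n m → n ∈ S

namespace IsSheet

variable {X Λ : Type*} [Lattice Λ] [RankedLattice Λ] {adj padj : X → X → Prop} {S : Set X}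
  {ℓ : X → Λ} {a t d : Λ} (h : IsSheet adj padj S ℓ a t d) {x y l : X}
include h

theorem sameSheet (hx : x ∈ S) (hy : y ∈ S) (hxy : x ≠ y ∨ rk a + 3 ≤ rk t) :
    SameSheet padj x y := by
  obtain ⟨m, n, hm', hn', hmn, h1, h2, h3, h4, h5⟩ := exists_two_transversals (h.slit x hx)
    (h.slit y hy) (hxy.imp_left fun hne he => hne (h.inj x hx y hy he))
  obtain ⟨m, hm, rfl⟩ := h.surj m hm'
  obtain ⟨n, hn, rfl⟩ := h.surj n hn'
  exact ⟨m, n, fun he => hmn (he ▸ rfl), h.padj_of _ hm _ hn h1, h.padj_of _ hx _ hm h2,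
    h.padj_of _ hx _ hn h3, h.padj_of _ hy _ hm h4, h.padj_of _ hy _ hn h5⟩

theorem rk_inf (hx : x ∈ S) (hy : y ∈ S) (hne : x ≠ y) (hxy : adj x y) :
    rk (ℓ x ⊓ ℓ y) = rk a + 1 := by
  have h1 := (h.adj_iff x hx y hy).1 hxy
  have hxr := (h.slit x hx).2.2.1
  have hyr := (h.slit y hy).2.2.1
  have h2 : ¬ ℓ x ≤ ℓ y := fun hle => hne (h.inj x hx y hy (eq_of_le_of_rk_le hle (by omega)))
  have := rk_inf_lt h2
  omega

/-- In a sheet of rank at least four the pencils are given by `InPencil`. -/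
theorem inPencil_iff_of_thick (ht : rk a + 4 ≤ rk t) (hx : x ∈ S) (hy : y ∈ S) (hne : x ≠ y)
    (hxy : adj x y) : InPencil adj l x y ↔ l ∈ S ∧ ℓ x ⊓ ℓ y ≤ ℓ l ∧ ℓ l ≤ ℓ x ⊔ ℓ y := by
  have hr := h.rk_inf hx hy hne hxy
  have hT : Thick adj x y := by
    obtain ⟨m, n, hm', hn', h1, h2, h3, h4, h5⟩ := exists_not_meet ht (h.slit x hx) (h.slit y hy) hr
    obtain ⟨m, hm, rfl⟩ := h.surj m hm'
    obtain ⟨n, hn, rfl⟩ := h.surj n hn'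
    exact ⟨m, n, (h.adj_iff m hm x hx).2 h1, (h.adj_iff m hm y hy).2 h2, (h.adj_iff n hn x hx).2 h3,
      (h.adj_iff n hn y hy).2 h4, fun hmn => h5 ((h.adj_iff m hm n hn).1 hmn)⟩
  have key : ∀ hl : l ∈ S, (adj l x ∧ adj l y ∧ ∀ m, adj m x → adj m y → adj m l) ↔
      ℓ x ⊓ ℓ y ≤ ℓ l ∧ ℓ l ≤ ℓ x ⊔ ℓ y := by
    intro hl
    rw [← forall_meet_iff ht (h.slit x hx) (h.slit y hy) hr (h.slit l hl), h.adj_iff l hl x hx,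
      h.adj_iff l hl y hy]
    refine and_congr_right fun _ => and_congr_right fun _ => ⟨fun hall m hm h1 h2 => ?_,
      fun hall m h1 h2 => ?_⟩
    · obtain ⟨m, hmS, rfl⟩ := h.surj m hm
      exact (h.adj_iff m hmS l hl).1 (hall m ((h.adj_iff m hmS x hx).2 h1)
        ((h.adj_iff m hmS y hy).2 h2))
    · have hmS := h.closed x hx y hy hne m h1 h2
      exact (h.adj_iff m hmS l hl).2 (hall _ (h.slit m hmS) ((h.adj_iff m hmS x hx).1 h1)
        ((h.adj_iff m hmS y hy).1 h2))
  constructor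
  · rintro ⟨hall, -⟩
    have hl := h.closed x hx y hy hne l hall.1 hall.2.1
    exact ⟨hl, (key hl).1 hall⟩
  · rintro ⟨hl, hp⟩
    exact ⟨(key hl).2 hp, Or.inl hT⟩

-- The pencils of the sheet are given by `InPencil`.
variable (hpen : ∀ x ∈ S, ∀ y ∈ S, x ≠ y → adj x y → ∀ l, InPencil adj l x y ↔
  l ∈ S ∧ ℓ x ⊓ ℓ y ≤ ℓ l ∧ ℓ l ≤ ℓ x ⊔ ℓ y)
include hpen

/-- The Veblen axiom does not fail at a point off the slit. -/
theorem inf_le_of_veblenFails (hx : x ∈ S) (hy : y ∈ S) (hV : VeblenFails adj x y) :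
    ℓ x ⊓ ℓ y ≤ d := by
  obtain ⟨c, e, o, ⟨hxy, hce, hxc, hye⟩, ⟨axy, ace, axc, aye, acy, aex⟩, ho1, ho2, hno⟩ := hV
  by_contra hd
  have hcS := h.closed x hx y hy hxy c (h.symm _ _ axc) acy
  have heS := h.closed x hx y hy hxy e aex (h.symm _ _ aye)
  obtain ⟨hoS, -, ho1⟩ := (hpen x hx c hcS hxc axc o).1 ho1
  obtain ⟨-, -, ho2⟩ := (hpen y hy e heS hye aye o).1 ho2
  obtain ⟨l, hl, l1, l2, l3, l4⟩ := exists_slitLine_of_veblen (h.slit x hx) (h.slit y hy)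
    (h.slit c hcS) (h.slit e heS) (h.slit o hoS) (h.rk_inf hx hy hxy axy)
    (h.rk_inf hcS heS hce ace) (h.rk_inf hx hcS hxc axc) (h.rk_inf hy heS hye aye)
    ((h.adj_iff c hcS y hy).1 acy) ((h.adj_iff e heS x hx).1 aex) ho1 ho2 hd
  obtain ⟨l, hlS, rfl⟩ := h.surj l hl
  exact hno ⟨l, (hpen x hx y hy hxy axy l).2 ⟨hlS, l1, l2⟩, (hpen c hcS e heS hce ace l).2
    ⟨hlS, l3, l4⟩⟩

/-- Unless the slit is a single point, each line through a point of the slit is in a pencil at that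
point at which the Veblen axiom fails. -/
theorem exists_veblenFails (hx : x ∈ S) {u : Λ} (hau : a ≤ u) (hu : rk u = rk a + 1)
    (hux : u ≤ ℓ x) (hud : u ≤ d) (hd : rk a + 2 ≤ rk d) :
    ∃ y ∈ S, x ≠ y ∧ u ≤ ℓ y ∧ VeblenFails adj x y := by
  obtain ⟨b₂, b₃, b₄, o, p, h2, h3, h4, ho, ⟨l1, l2, l3, l4, hp⟩, ⟨n12, n34, n13, n24⟩, hu2,
    ⟨o1, o1'⟩, ⟨o2, o2'⟩, hno⟩ := exists_veblen_failure (h.slit x hx) hau hu hux hud hd h.le_top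
  obtain ⟨y, hy, rfl⟩ := h.surj b₂ h2
  obtain ⟨c, hc, rfl⟩ := h.surj b₃ h3
  obtain ⟨e, he, rfl⟩ := h.surj b₄ h4
  obtain ⟨o, hoS, rfl⟩ := h.surj o ho
  have adj' : ∀ v ∈ S, ∀ w ∈ S, ℓ v ≤ p → ℓ w ≤ p → adj v w := fun v hv w hw hvp hwp => by
    refine (h.adj_iff v hv w hw).2 ?_
    have := rk_le_rk_inf hvp hwp
    have := (h.slit v hv).2.2.1
    have := (h.slit w hw).2.2.1
    omega
  have ne : ∀ {v w : X}, ℓ v ≠ ℓ w → v ≠ w := fun hne he => hne (he ▸ rfl)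
  have axy := adj' x hx y hy l1 l2
  have ace := adj' c hc e he l3 l4
  have axc := adj' x hx c hc l1 l3
  have aye := adj' y hy e he l2 l4
  refine ⟨y, hy, ne n12, hu2, c, e, o, ⟨ne n12, ne n34, ne n13, ne n24⟩, ⟨axy, ace, axc, aye,
    adj' c hc y hy l3 l2, adj' e he x hx l4 l1⟩, (hpen x hx c hc (ne n13) axc o).2 ⟨hoS, o1, o1'⟩,
    (hpen y hy e he (ne n24) aye o).2 ⟨hoS, o2, o2'⟩, ?_⟩
  rintro ⟨l, hl1, hl2⟩
  obtain ⟨hl, k1, -⟩ := (hpen x hx y hy (ne n12) axy l).1 hl1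
  obtain ⟨-, k2, -⟩ := (hpen c hc e he (ne n34) ace l).1 hl2
  exact hno _ (h.slit l hl) k1 k2

end IsSheet

end Sheets

/-! ### Lines of the spine space as pairs of subspaces -/

section Coordinates

variable {K V : Type*} [DivisionRing K] [AddCommGroup V] [Module K V]
  {W : Submodule K V} {k m : ℕ}

variable (W k m) in
/-- The pairs `(H, B)` that span a line of the spine space, in terms of the dimensions of `H ⊓ W`
and `B ⊓ W`. -/
def IsSpinePair (H B : Submodule K V) : Prop :=
  H ≤ B ∧ finrank K H + 1 = k ∧ finrank K B = k + 1 ∧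
    ((finrank K (H ⊓ W : Submodule K V) = m ∧ finrank K (B ⊓ W : Submodule K V) = m) ∨
     (finrank K (H ⊓ W : Submodule K V) = m ∧ finrank K (B ⊓ W : Submodule K V) = m + 1) ∨
     (finrank K (H ⊓ W : Submodule K V) + 1 = m ∧ finrank K (B ⊓ W : Submodule K V) = m + 1))

variable (W k m) in
/-- A parametrization of the lines of the spine space by the pairs `(H, B)` that span them. -/
structure LineCoords (X : Type*) where
  /-- The subspace `H` of the line `{U : H ≤ U ≤ B}`. -/
  lower : X → Submodule K V
  /-- The subspace `B` of the line `{U : H ≤ U ≤ B}`. -/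
  upper : X → Submodule K V
  isSpinePair : ∀ l, IsSpinePair W k m (lower l) (upper l)
  ext : ∀ l l', lower l = lower l' → upper l = upper l' → l = l'
  surj : ∀ H B, IsSpinePair W k m H B → ∃ l, lower l = H ∧ upper l = B

namespace LineCoords

variable {X : Type*} (c : LineCoords W k m X)

/-- Two lines are in a common star or in a common top. -/
def Share (x y : X) : Prop := c.lower x = c.lower y ∨ c.upper x = c.upper y

/-- The closure of the line `x` passes through `U`. -/
def Thru (U : Submodule K V) (x : X) : Prop := c.lower x ≤ U ∧ U ≤ c.upper x

/-- Lines of a common star or top whose closures meet. -/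
def Adj (x y : X) : Prop :=
  c.Share x y ∧ ∃ U : Submodule K V, finrank K U = k ∧ c.Thru U x ∧ c.Thru U y

/-- Lines of a common star or top that meet in a proper point. -/
def PAdj (x y : X) : Prop :=
  c.Share x y ∧ ∃ U : Submodule K V, finrank K U = k ∧ finrank K (U ⊓ W : Submodule K V) = m ∧
    c.Thru U x ∧ c.Thru U y

variable {c} {x y z : X}

theorem PAdj.adj (h : c.PAdj x y) : c.Adj x y := by
  obtain ⟨h1, U, hU, -, h2⟩ := h
  exact ⟨h1, U, hU, h2⟩

theorem Share.symm (h : c.Share x y) : c.Share y x := h.imp Eq.symm Eq.symm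

theorem Adj.symm (h : c.Adj x y) : c.Adj y x :=
  let ⟨h1, U, hU, h2, h3⟩ := h
  ⟨h1.symm, U, hU, h3, h2⟩

theorem lower_eq_of_share (hne : x ≠ y) (h : c.lower x = c.lower y) (hx : c.Share z x)
    (hy : c.Share z y) : c.lower z = c.lower x := by
  rcases hx with hx | hx
  · exact hx
  rcases hy with hy | hy
  · exact hy.trans h.symm
  · exact absurd (c.ext x y h (hx.symm.trans hy)) hne

theorem upper_eq_of_share (hne : x ≠ y) (h : c.upper x = c.upper y) (hx : c.Share z x)
    (hy : c.Share z y) : c.upper z = c.upper x := by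
  rcases hx with hx | hx
  · rcases hy with hy | hy
    · exact absurd (c.ext x y (hx.symm.trans hy) h) hne
    · exact hy.trans h.symm
  · exact hx

variable (c)

theorem lower_le (x : X) : c.lower x ≤ c.upper x := (c.isSpinePair x).1

theorem finrank_lower (x : X) : finrank K (c.lower x) + 1 = k := (c.isSpinePair x).2.1

theorem finrank_upper (x : X) : finrank K (c.upper x) = k + 1 := (c.isSpinePair x).2.2.1

end LineCoords

variable [FiniteDimensional K V]

theorem finrank_inf_mono {H B : Submodule K V} (hHB : H ≤ B) :
    finrank K (H ⊓ W : Submodule K V) ≤ finrank K (B ⊓ W : Submodule K V) ∧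
    finrank K (B ⊓ W : Submodule K V) + finrank K H ≤
      finrank K (H ⊓ W : Submodule K V) + finrank K B := by
  refine ⟨Submodule.finrank_mono (inf_le_inf_right W hHB), ?_⟩
  have h1 := Submodule.finrank_sup_add_finrank_inf_eq H (B ⊓ W)
  rw [← inf_assoc, inf_eq_left.2 hHB] at h1
  have h2 := Submodule.finrank_mono (sup_le hHB (inf_le_left : B ⊓ W ≤ B))
  omega

theorem le_sup_iff_finrank {H B : Submodule K V} (hHB : H ≤ B) :
    B ≤ H ⊔ W ↔ finrank K B + finrank K (H ⊓ W : Submodule K V) =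
      finrank K H + finrank K (B ⊓ W : Submodule K V) := by
  have h1 := Submodule.finrank_sup_add_finrank_inf_eq H (B ⊓ W)
  rw [← inf_assoc, inf_eq_left.2 hHB, inf_comm B W, ← sup_inf_assoc_of_le W hHB, inf_comm W B] at h1
  constructor
  · intro h
    rw [inf_eq_right.2 h] at h1
    omega
  · intro h
    exact inf_eq_right.1 (Submodule.eq_of_le_of_finrank_le inf_le_right (by omega))

theorem inf_le_iff_finrank {H B : Submodule K V} (hHB : H ≤ B) :
    B ⊓ W ≤ H ↔ finrank K (H ⊓ W : Submodule K V) = finrank K (B ⊓ W : Submodule K V) := by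
  constructor
  · intro h
    rw [le_antisymm (inf_le_inf_right W hHB) (le_inf h inf_le_right)]
  · intro h
    rw [← Submodule.eq_of_le_of_finrank_eq (inf_le_inf_right W hHB) h]
    exact inf_le_left

/-- The star of `H` is a slit space. -/
theorem exists_slit_star (hn : k + 3 ≤ finrank K V) {H : Submodule K V} (hH : finrank K H + 1 = k)
    (hm : finrank K (H ⊓ W : Submodule K V) = m ∨ finrank K (H ⊓ W : Submodule K V) + 1 = m) :
    ∃ t d : Submodule K V, H ≤ d ∧ d ≤ t ∧
      (∀ U, H ≤ U → finrank K U = k →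
        (finrank K (U ⊓ W : Submodule K V) = m ↔ U ≤ t ∧ ¬ U ≤ d)) ∧
      (∀ B, H ≤ B → finrank K B = k + 1 → (IsSpinePair W k m H B ↔ B ≤ t ∧ ¬ B ≤ d)) ∧
      (k + 3 ≤ finrank K t ∨ finrank K (H ⊓ W : Submodule K V) + 1 = m) := by
  rcases hm with hm | hm
  · refine ⟨⊤, H ⊔ W, le_sup_left, le_top, fun U hU hUr => ?_, fun B hB hBr => ?_,
      Or.inl (by rw [finrank_top]; omega)⟩
    · have := finrank_inf_mono (W := W) hU
      rw [le_sup_iff_finrank hU]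
      simp only [le_top, true_and]
      omega
    · have := finrank_inf_mono (W := W) hB
      rw [le_sup_iff_finrank hB, IsSpinePair]
      simp only [le_top, true_and, hB]
      omega
  · refine ⟨H ⊔ W, H, le_rfl, le_sup_left, fun U hU hUr => ?_, fun B hB hBr => ?_, Or.inr hm⟩
    · have := finrank_inf_mono (W := W) hU
      have h1 : ¬ U ≤ H := fun h => by have := Submodule.finrank_mono h; omega
      rw [le_sup_iff_finrank hU]
      simp only [h1, not_false_eq_true, and_true]
      omega
    · have := finrank_inf_mono (W := W) hB
      have h1 : ¬ B ≤ H := fun h => by have := Submodule.finrank_mono h; omega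
      rw [le_sup_iff_finrank hB, IsSpinePair]
      simp only [h1, not_false_eq_true, and_true, true_and, hB]
      omega

/-- The top of `B` is a slit space of rank at least four, in the dual order. -/
theorem exists_slit_top (hn : k + 3 ≤ finrank K V) (hk : m + 3 ≤ k) {B : Submodule K V}
    (hB : finrank K B = k + 1)
    (hm : finrank K (B ⊓ W : Submodule K V) = m ∨ finrank K (B ⊓ W : Submodule K V) = m + 1) :
    ∃ t d : (Submodule K V)ᵒᵈ, toDual B ≤ d ∧ d ≤ t ∧
      (∀ U, U ≤ B → finrank K U = k →
        (finrank K (U ⊓ W : Submodule K V) = m ↔ toDual U ≤ t ∧ ¬ toDual U ≤ d)) ∧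
      (∀ H, H ≤ B → finrank K H + 1 = k →
        (IsSpinePair W k m H B ↔ toDual H ≤ t ∧ ¬ toDual H ≤ d)) ∧
      rk (toDual B) + 4 ≤ rk t ∧ (d = toDual B ∨ rk (toDual B) + 2 ≤ rk d) := by
  rcases hm with hm | hm
  · refine ⟨toDual (B ⊓ W), toDual B, le_rfl, toDual_le_toDual.2 inf_le_left, fun U hU hUr => ?_,
      fun H hH hHr => ?_, ?_, Or.inl rfl⟩
    · have h1 : ¬ B ≤ U := fun h => by have := Submodule.finrank_mono h; omega
      simp only [toDual_le_toDual, h1, not_false_eq_true, and_true, inf_le_iff_finrank hU]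
      omega
    · have h1 : ¬ B ≤ H := fun h => by have := Submodule.finrank_mono h; omega
      simp only [toDual_le_toDual, h1, not_false_eq_true, and_true, inf_le_iff_finrank hH,
        IsSpinePair, hH, true_and]
      omega
    · rw [rk_toDual, rk_toDual]
      omega
  · refine ⟨toDual ⊥, toDual (B ⊓ W), toDual_le_toDual.2 inf_le_left, toDual_le_toDual.2 bot_le,
      fun U hU hUr => ?_, fun H hH hHr => ?_, ?_, Or.inr ?_⟩
    · have := finrank_inf_mono (W := W) hU
      simp only [toDual_le_toDual, bot_le, true_and, inf_le_iff_finrank hU]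
      omega
    · have := finrank_inf_mono (W := W) hH
      simp only [toDual_le_toDual, bot_le, true_and, inf_le_iff_finrank hH, IsSpinePair, hH]
      omega
    · rw [rk_toDual, rk_toDual, finrank_bot]
      omega
    · rw [rk_toDual, rk_toDual]
      omega

namespace LineCoords

variable {X : Type*} (c : LineCoords W k m X)

/-- The lines in a star form a sheet. -/
theorem exists_isSheet_star (hn : k + 3 ≤ finrank K V) (x : X) :
    ∃ t d : Submodule K V,
      IsSheet c.Adj c.PAdj {l | c.lower l = c.lower x} c.upper (c.lower x) t d ∧ c.lower x ≤ d ∧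
      (∀ U, c.lower x ≤ U → finrank K U = k →
        (finrank K (U ⊓ W : Submodule K V) = m ↔ U ≤ t ∧ ¬ U ≤ d)) ∧
      (k + 3 ≤ finrank K t ∨ finrank K (c.lower x ⊓ W : Submodule K V) + 1 = m) := by
  have hp := c.isSpinePair x
  obtain ⟨t, d, hHd, hdt, hU, hB, ht⟩ := exists_slit_star (W := W) (m := m) hn
    (c.finrank_lower x) (by have := hp.2.2.2; omega)
  have hx := c.finrank_lower x
  refine ⟨t, d, ⟨?_, ?_, ?_, hdt, ?_, ?_, fun _ _ => Adj.symm, ?_⟩, hHd, hU, ht⟩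
  · intro l hl
    have h1 := c.isSpinePair l
    have hl : c.lower l = c.lower x := hl
    rw [hl] at h1
    obtain ⟨h2, h3⟩ := (hB _ h1.1 h1.2.2.1).1 h1
    exact ⟨h1.1, h2, by rw [rk_eq, rk_eq]; have := h1.2.2.1; omega, h3⟩
  · exact fun l hl l' hl' h => c.ext l l' (Eq.trans hl (Eq.symm hl')) h
  · rintro b ⟨h1, h2, h3, h4⟩
    rw [rk_eq, rk_eq] at h3
    exact c.surj _ _ ((hB b h1 (by omega)).2 ⟨h2, h4⟩)
  · intro l hl l' hl'
    have hl : c.lower l = c.lower x := hl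
    have hl' : c.lower l' = c.lower x := hl'
    simp only [rk_eq, hx]
    constructor
    · rintro ⟨-, U, hUr, h1, h2⟩
      exact hUr.ge.trans (Submodule.finrank_mono (le_inf h1.2 h2.2))
    · intro h
      have h1 : c.lower x ≤ c.upper l ⊓ c.upper l' :=
        le_inf (hl ▸ c.lower_le l) (hl' ▸ c.lower_le l')
      obtain ⟨U, hU1, hU2, hU3⟩ := RankedLattice.exists_between (r := k) h1
        (by rw [rk_eq]; omega) h
      exact ⟨Or.inl (hl.trans hl'.symm), U, hU3, ⟨hl ▸ hU1, hU2.trans inf_le_left⟩,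
        ⟨hl' ▸ hU1, hU2.trans inf_le_right⟩⟩
  · rintro l hl l' hl' ⟨u, h1, h2, h3, h4, h5⟩
    have hl : c.lower l = c.lower x := hl
    have hl' : c.lower l' = c.lower x := hl'
    rw [rk_eq, rk_eq, hx] at h2
    have h6 := c.isSpinePair l
    rw [hl] at h6
    have h7 := (hB _ h6.1 h6.2.2.1).1 h6
    exact ⟨Or.inl (hl.trans hl'.symm), u, h2, (hU u h1 h2).2 ⟨h3.trans h7.1, h5⟩, ⟨hl ▸ h1, h3⟩,
      ⟨hl' ▸ h1, h4⟩⟩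
  · intro l hl l' hl' hne n h1 h2
    exact (lower_eq_of_share hne (Eq.trans hl (Eq.symm hl')) h1.1 h2.1).trans hl

/-- The lines in a top form a sheet of rank at least four. -/
theorem exists_isSheet_top (hn : k + 3 ≤ finrank K V) (hk : m + 3 ≤ k) (x : X) :
    ∃ t d : (Submodule K V)ᵒᵈ,
      IsSheet c.Adj c.PAdj {l | c.upper l = c.upper x} (fun l => toDual (c.lower l))
        (toDual (c.upper x)) t d ∧ toDual (c.upper x) ≤ d ∧
      (∀ U, U ≤ c.upper x → finrank K U = k →
        (finrank K (U ⊓ W : Submodule K V) = m ↔ toDual U ≤ t ∧ ¬ toDual U ≤ d)) ∧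
      rk (toDual (c.upper x)) + 4 ≤ rk t ∧
      (d = toDual (c.upper x) ∨ rk (toDual (c.upper x)) + 2 ≤ rk d) := by
  have hp := c.isSpinePair x
  obtain ⟨t, d, hHd, hdt, hU, hB, ht⟩ := exists_slit_top (W := W) (m := m) hn hk
    (c.finrank_upper x) (by have := hp.2.2.2; omega)
  have hx := c.finrank_upper x
  have hle : ∀ U : Submodule K V, finrank K U ≤ finrank K V := Submodule.finrank_le
  refine ⟨t, d, ⟨?_, ?_, ?_, hdt, ?_, ?_, fun _ _ => Adj.symm, ?_⟩, hHd, hU, ht⟩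
  · intro l hl
    have h1 := c.isSpinePair l
    have hl : c.upper l = c.upper x := hl
    rw [hl] at h1
    obtain ⟨h2, h3⟩ := (hB _ h1.1 h1.2.1).1 h1
    exact ⟨h1.1, h2, by rw [rk_toDual, rk_toDual]; have := h1.2.1; omega, h3⟩
  · exact fun l hl l' hl' h => c.ext l l' h (Eq.trans hl (Eq.symm hl'))
  · rintro b ⟨h1, h2, h3, h4⟩
    have hb := hle (ofDual b : Submodule K V)
    have h3 : finrank K V - finrank K (ofDual b : Submodule K V) =
      finrank K V - finrank K (c.upper x) + 2 := h3
    obtain ⟨l, h5, h6⟩ := c.surj _ _ ((hB (ofDual b) h1 (by omega)).2 ⟨h2, h4⟩)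
    exact ⟨l, h6, congrArg toDual h5⟩
  · intro l hl l' hl'
    have hl : c.upper l = c.upper x := hl
    have hl' : c.upper l' = c.upper x := hl'
    have e : rk (toDual (c.lower l) ⊓ toDual (c.lower l')) =
      finrank K V - finrank K (c.lower l ⊔ c.lower l' : Submodule K V) := rfl
    rw [e, rk_toDual, hx]
    have hs := hle (c.lower l ⊔ c.lower l')
    have h1 : c.lower l ⊔ c.lower l' ≤ c.upper x :=
      sup_le (hl ▸ c.lower_le l) (hl' ▸ c.lower_le l')
    constructor
    · rintro ⟨-, U, hUr, h1, h2⟩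
      have := Submodule.finrank_mono (sup_le h1.1 h2.1)
      omega
    · intro h
      obtain ⟨U, hU1, hU2, hU3⟩ := RankedLattice.exists_between (r := k) h1
        (by rw [rk_eq]; omega) (by rw [rk_eq]; omega)
      exact ⟨Or.inr (hl.trans hl'.symm), U, hU3, ⟨le_sup_left.trans hU1, hl ▸ hU2⟩,
        ⟨le_sup_right.trans hU1, hl' ▸ hU2⟩⟩
  · rintro l hl l' hl' ⟨u, h1, h2, h3, h4, h5⟩
    have hl : c.upper l = c.upper x := hl
    have hl' : c.upper l' = c.upper x := hl'
    have hu := hle (ofDual u : Submodule K V)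
    have h2 : finrank K V - finrank K (ofDual u : Submodule K V) =
      finrank K V - finrank K (c.upper x) + 1 := h2
    have h2 : finrank K (ofDual u : Submodule K V) = k := by omega
    have h6 := c.isSpinePair l
    rw [hl] at h6
    have h7 := (hB _ h6.1 h6.2.1).1 h6
    exact ⟨Or.inr (hl.trans hl'.symm), ofDual u, h2, (hU (ofDual u) h1 h2).2 ⟨h3.trans h7.1, h5⟩,
      ⟨h3, hl ▸ h1⟩, ⟨h4, hl' ▸ h1⟩⟩
  · intro l hl l' hl' hne n h1 h2
    exact (upper_eq_of_share hne (Eq.trans hl (Eq.symm hl')) h1.1 h2.1).trans hl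

end LineCoords

end Coordinates

section Coordinates

variable {K V : Type*} [DivisionRing K] [AddCommGroup V] [Module K V] [FiniteDimensional K V]
  {W : Submodule K V} {k m : ℕ}

namespace LineCoords

/-! ### Grids of lines through a common point -/

variable {X : Type*} (c : LineCoords W k m X) {x y z w l : X} {U U' : Submodule K V}

theorem inf_eq_of_thru (hne : x ≠ y) (h : c.lower x = c.lower y) (hU : finrank K U = k)
    (hx : c.Thru U x) (hy : c.Thru U y) : c.upper x ⊓ c.upper y = U := by
  have h1 : ¬ c.upper x ≤ c.upper y := fun hle => hne (c.ext x y h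
    (Submodule.eq_of_le_of_finrank_eq hle ((c.finrank_upper x).trans (c.finrank_upper y).symm)))
  have h2 := rk_inf_lt h1
  have h3 := c.finrank_upper x
  rw [rk_eq, rk_eq] at h2
  exact (Submodule.eq_of_le_of_finrank_le (le_inf hx.2 hy.2) (by omega)).symm

theorem sup_eq_of_thru (hne : x ≠ y) (h : c.upper x = c.upper y) (hU : finrank K U = k)
    (hx : c.Thru U x) (hy : c.Thru U y) : c.lower x ⊔ c.lower y = U := by
  have h1 : ¬ c.lower x ≤ c.lower y := fun hle => hne (c.ext x y
    (Submodule.eq_of_le_of_finrank_eq hle (by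
      have := c.finrank_lower x; have := c.finrank_lower y; omega)) h)
  have h2 := rk_inf_lt h1
  have h4 := rk_sup_add_inf (c.lower x) (c.lower y)
  have h3 := c.finrank_lower x
  have h5 := c.finrank_lower y
  rw [rk_eq, rk_eq] at h2
  rw [rk_eq, rk_eq, rk_eq, rk_eq] at h4
  exact Submodule.eq_of_le_of_finrank_le (sup_le hx.1 hy.1) (by omega)

theorem thru_unique (hne : x ≠ y) (h : c.Share x y) (hU : finrank K U = k) (hU' : finrank K U' = k)
    (hx : c.Thru U x) (hy : c.Thru U y) (hx' : c.Thru U' x) (hy' : c.Thru U' y) : U = U' := by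
  rcases h with h | h
  · rw [← c.inf_eq_of_thru hne h hU hx hy, ← c.inf_eq_of_thru hne h hU' hx' hy']
  · rw [← c.sup_eq_of_thru hne h hU hx hy, ← c.sup_eq_of_thru hne h hU' hx' hy']

/-- A line through an improper point has `dim (H ⊓ W) = m` and `dim (B ⊓ W) = m + 1`. -/
theorem finrank_of_improper (hU : finrank K U = k) (hx : c.Thru U x)
    (him : finrank K (U ⊓ W : Submodule K V) ≠ m) :
    finrank K (c.lower x ⊓ W : Submodule K V) = m ∧
      finrank K (c.upper x ⊓ W : Submodule K V) = m + 1 ∧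
      finrank K (U ⊓ W : Submodule K V) = m + 1 := by
  have h1 := finrank_inf_mono (W := W) hx.1
  have h2 := finrank_inf_mono (W := W) hx.2
  obtain ⟨-, h3, h4, h5⟩ := c.isSpinePair x
  omega

section Sheets

-- `δ` is `π` or `ρ`: both are between `c.PAdj` and `c.Share`.
variable (hn : k + 3 ≤ finrank K V) (hk : m + 3 ≤ k) {δ : X → X → Prop}
  (hδ : ∀ x y, c.PAdj x y → δ x y) (hδ' : ∀ x y, δ x y → c.Share x y)
include hn hk hδ hδ'

/-- `SameSheet` holds for the lines of a common star or top. -/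
theorem sameSheet_iff : SameSheet δ x y ↔ c.Share x y := by
  constructor
  · rintro ⟨n, n', hne, h1, h2, h3, h4, h5⟩
    rcases hδ' _ _ h1 with h | h
    · left
      rw [lower_eq_of_share hne h (hδ' _ _ h2) (hδ' _ _ h3),
        lower_eq_of_share hne h (hδ' _ _ h4) (hδ' _ _ h5)]
    · right
      rw [upper_eq_of_share hne h (hδ' _ _ h2) (hδ' _ _ h3),
        upper_eq_of_share hne h (hδ' _ _ h4) (hδ' _ _ h5)]
  · intro h
    have key : SameSheet c.PAdj x y := by
      obtain ⟨t, d, hs, -, -, hr, -⟩ := c.exists_isSheet_top hn hk x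
      rcases h with h | h
      · by_cases hne : x = y
        · exact hs.sameSheet rfl (congrArg c.upper hne.symm) (Or.inr (by omega))
        · obtain ⟨t, d, hs, -⟩ := c.exists_isSheet_star hn x
          exact hs.sameSheet rfl h.symm (Or.inl hne)
      · exact hs.sameSheet rfl h.symm (Or.inr (by omega))
    obtain ⟨n, n', h0, h1, h2, h3, h4, h5⟩ := key
    exact ⟨n, n', h0, hδ _ _ h1, hδ _ _ h2, hδ _ _ h3, hδ _ _ h4, hδ _ _ h5⟩

theorem rect_iff : Rect δ x y z w ↔ c.Share x y ∧ c.Share y z ∧ c.Share z w ∧ c.Share w x ∧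
    ¬ c.Share x z ∧ ¬ c.Share y w := by
  simp only [Rect, c.sameSheet_iff hn hk hδ hδ']

/-- The four lines of a four-cycle have a common point. -/
theorem exists_thru_of_rect (h : Rect δ x y z w) :
    x ≠ y ∧ x ≠ w ∧ c.Share x y ∧ c.Share x w ∧
      ∃ U : Submodule K V, finrank K U = k ∧ c.Thru U x ∧ c.Thru U y ∧ c.Thru U w := by
  obtain ⟨h1, h2, h3, h4, h5, h6⟩ := (c.rect_iff hn hk hδ hδ').1 h
  refine ⟨fun h => h6 (h ▸ h4.symm), fun h => h6 (h ▸ h1.symm), h1, h4.symm, ?_⟩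
  have lx := c.lower_le x
  have ly := c.lower_le y
  have lz := c.lower_le z
  have lw := c.lower_le w
  have hx := c.finrank_upper x
  have hx' := c.finrank_lower x
  have hw' := c.finrank_lower w
  have fin : ∀ {H H' B B' : Submodule K V}, H ≤ B → H ≤ B' → H' ≤ B → H' ≤ B' →
      finrank K H + 1 = k → finrank K H' + 1 = k → finrank K B = k + 1 → finrank K B' = k + 1 →
      H ≠ H' → B ≠ B' → ∃ U : Submodule K V, finrank K U = k ∧
        H ≤ U ∧ H' ≤ U ∧ U ≤ B ∧ U ≤ B' := by
    intro H H' B B' a1 a2 a3 a4 r1 r2 r3 r4 n1 n2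
    have e1 : ¬ H ≤ H' := fun h => n1 (Submodule.eq_of_le_of_finrank_eq h (by omega))
    have e2 := rk_inf_lt e1
    have e3 := rk_sup_add_inf H H'
    rw [rk_eq, rk_eq] at e2
    rw [rk_eq, rk_eq, rk_eq, rk_eq] at e3
    have e4 : ¬ B ≤ B' := fun h => n2 (Submodule.eq_of_le_of_finrank_eq h (by omega))
    have e5 := rk_inf_lt e4
    rw [rk_eq, rk_eq] at e5
    have e6 := Submodule.finrank_mono (le_inf (sup_le a1 a3) (sup_le a2 a4))
    exact ⟨H ⊔ H', by omega, le_sup_left, le_sup_right, sup_le a1 a3, sup_le a2 a4⟩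
  rcases h1 with h1 | h1
  · have e2 : c.upper y = c.upper z := h2.resolve_left fun h => h5 (Or.inl (h1.trans h))
    have e4 : c.upper w = c.upper x := h4.resolve_left fun h => h6 (Or.inl (h1.symm.trans h.symm))
    have e3 : c.lower z = c.lower w := h3.resolve_right fun h => h6 (Or.inr (e2.trans h))
    obtain ⟨U, r, u1, u2, u3, u4⟩ := fin lx (h1 ▸ ly) (e4 ▸ lw) (e3 ▸ e2 ▸ lz) hx' hw' hx
      (c.finrank_upper y) (fun h => h6 (Or.inl (h1.symm.trans h)))
      (fun h => h5 (Or.inr (h.trans e2)))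
    exact ⟨U, r, ⟨u1, u3⟩, ⟨h1 ▸ u1, u4⟩, ⟨u2, e4 ▸ u3⟩⟩
  · have e2 : c.lower y = c.lower z := h2.resolve_right fun h => h5 (Or.inr (h1.trans h))
    have e4 : c.lower w = c.lower x := h4.resolve_right fun h => h6 (Or.inr (h1.symm.trans h.symm))
    have e3 : c.upper z = c.upper w := h3.resolve_left fun h => h6 (Or.inl (e2.trans h))
    obtain ⟨U, r, u1, u2, u3, u4⟩ := fin lx (e4 ▸ lw) (h1 ▸ ly) (e3 ▸ e2 ▸ lz) hx'
      (c.finrank_lower y) hx (c.finrank_upper w) (fun h => h5 (Or.inl (h.trans e2)))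
      (fun h => h6 (Or.inr (h1.symm.trans h)))
    exact ⟨U, r, ⟨u1, u3⟩, ⟨u2, h1 ▸ u3⟩, ⟨e4 ▸ u1, u4⟩⟩

theorem thru_of_rect (h : Rect δ x y z w) (hU : finrank K U = k) (hx : c.Thru U x)
    (hy : c.Thru U y) : c.Thru U w := by
  obtain ⟨h1, -, h2, -, U', hU', hx', hy', hw'⟩ := c.exists_thru_of_rect hn hk hδ hδ' h
  rwa [c.thru_unique h1 h2 hU hU' hx hy hx' hy']

theorem rect_of_lower (h1 : c.lower x = c.lower y) (h2 : c.upper y = c.upper z)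
    (h3 : c.lower z = c.lower w) (h4 : c.upper w = c.upper x) (hl : c.lower w ≠ c.lower x)
    (hu : c.upper y ≠ c.upper x) : Rect δ x y z w := by
  refine (c.rect_iff hn hk hδ hδ').2 ⟨Or.inl h1, Or.inr h2, Or.inl h3, Or.inr h4, ?_, ?_⟩
  · rintro (h | h)
    · exact hl (h3.symm.trans h.symm)
    · exact hu (h2.trans h.symm)
  · rintro (h | h)
    · exact hl (h.symm.trans h1.symm)
    · exact hu (h.trans h4)

theorem rect_of_upper (h1 : c.upper x = c.upper y) (h2 : c.lower y = c.lower z)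
    (h3 : c.upper z = c.upper w) (h4 : c.lower w = c.lower x) (hu : c.upper w ≠ c.upper x)
    (hl : c.lower y ≠ c.lower x) : Rect δ x y z w := by
  refine (c.rect_iff hn hk hδ hδ').2 ⟨Or.inr h1, Or.inl h2, Or.inr h3, Or.inl h4, ?_, ?_⟩
  · rintro (h | h)
    · exact hl (h2.trans h.symm)
    · exact hu (h3.symm.trans h.symm)
  · rintro (h | h)
    · exact hl (h.trans h4)
    · exact hu (h.symm.trans h1.symm)

variable (hcodim : k + finrank K W ≤ m + finrank K V)
include hcodim

/-- Through an improper point, every pair of subspaces `H` and `B` that occur in lines through it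
occurs in a line, so that two lines through it are always in a four-cycle. -/
theorem exists_rect_of_improper (hne : x ≠ y) (hxy : c.Share x y) (hU : finrank K U = k)
    (hx : c.Thru U x) (hy : c.Thru U y) (him : finrank K (U ⊓ W : Submodule K V) ≠ m) :
    ∃ z w, Rect δ x y z w := by
  obtain ⟨x1, x2, hu⟩ := c.finrank_of_improper hU hx him
  obtain ⟨y1, y2, -⟩ := c.finrank_of_improper hU hy him
  have hxl := c.finrank_lower x
  rcases hxy with h | h
  · have n1 : ¬ U ⊓ W ≤ ⊥ := fun h => by
      have := Submodule.finrank_mono h; rw [finrank_bot] at this; omega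
    have n2 : ¬ c.lower x ≤ ⊥ := fun h => by
      have := Submodule.finrank_mono h; rw [finrank_bot] at this; omega
    obtain ⟨H, -, hHU, hH, hHW, hHx⟩ := exists_hyperplane_not_le bot_le
      (inf_le_left : U ⊓ W ≤ U) n1 n2
    have hHm := finrank_inf_mono (W := W) hHU
    rw [inf_le_iff_finrank hHU] at hHW
    obtain ⟨w, w1, w2⟩ := c.surj H (c.upper x) ⟨hHU.trans hx.2, by omega, c.finrank_upper x,
      by omega⟩
    obtain ⟨z, z1, z2⟩ := c.surj H (c.upper y) ⟨hHU.trans hy.2, by omega, c.finrank_upper y,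
      by omega⟩
    exact ⟨z, w, c.rect_of_lower hn hk hδ hδ' h z2.symm (z1.trans w1.symm) w2
      (fun h => hHx (w1 ▸ h.ge)) (fun h' => hne (c.ext x y h h'.symm))⟩
  · have hxu := c.finrank_upper x
    have n1 : ¬ (⊤ : Submodule K V) ≤ U ⊔ W := fun h => by
      have h1 := Submodule.finrank_mono h
      have h2 := Submodule.finrank_sup_add_finrank_inf_eq U W
      rw [finrank_top] at h1
      omega
    have n2 : ¬ (⊤ : Submodule K V) ≤ c.upper x := fun h => by
      have h1 := Submodule.finrank_mono h
      rw [finrank_top] at h1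
      omega
    obtain ⟨B, hUB, -, hB, hBW, hBx⟩ := exists_atom le_top (le_sup_left : U ≤ U ⊔ W) n1 n2
    rw [rk_eq, rk_eq, hU] at hB
    have hBm := finrank_inf_mono (W := W) hUB
    rw [le_sup_iff_finrank hUB] at hBW
    obtain ⟨w, w1, w2⟩ := c.surj (c.lower x) B ⟨hx.1.trans hUB, hxl, hB, by omega⟩
    obtain ⟨z, z1, z2⟩ := c.surj (c.lower y) B ⟨hy.1.trans hUB, c.finrank_lower y, hB, by omega⟩
    exact ⟨z, w, c.rect_of_upper hn hk hδ hδ' h z1.symm (z2.trans w2.symm) w1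
      (fun h => hBx (w2 ▸ h.le)) (fun h' => hne (c.ext x y h'.symm h))⟩

end Sheets

variable (hn : k + 3 ≤ finrank K V) (hk : m + 3 ≤ k)
include hn hk

theorem exists_pAdj (x : X) : ∃ y, x ≠ y ∧ c.PAdj x y := by
  obtain ⟨n, n', hne, -, h1, h2, -⟩ := (c.sameSheet_iff (x := x) (y := x) hn hk
    (fun _ _ h => h) (fun _ _ h => h.1)).2 (Or.inl rfl)
  by_cases h : x = n
  · exact ⟨n', fun h' => hne (h.symm.trans h'), h2⟩
  · exact ⟨n, h, h1⟩

theorem coplanarFrom_iff (hcodim : k + finrank K W ≤ m + finrank K V) :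
    CoplanarFrom c.PAdj x y ↔ c.Adj x y := by
  constructor
  · rintro (h | ⟨z, w, h⟩)
    · exact h.adj
    · obtain ⟨-, -, h1, -, U, hU, hx, hy, -⟩ := c.exists_thru_of_rect hn hk (fun _ _ h => h)
        (fun _ _ h => h.1) h
      exact ⟨h1, U, hU, hx, hy⟩
  · rintro ⟨h, U, hU, hx, hy⟩
    by_cases hp : finrank K (U ⊓ W : Submodule K V) = m
    · exact Or.inl ⟨h, U, hU, hp, hx, hy⟩
    by_cases hne : x = y
    · obtain ⟨n, -, -, U', hU', hp', hx', -⟩ := c.exists_pAdj hn hk x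
      exact Or.inl ⟨h, U', hU', hp', hx', hne ▸ hx'⟩
    · exact Or.inr (c.exists_rect_of_improper hn hk (fun _ _ h => h) (fun _ _ h => h.1) hcodim
        hne h hU hx hy hp)

/-! ### Pencils -/

theorem inPencil_iff_of_lower (hne : x ≠ y) (h : c.lower x = c.lower y) (hxy : c.Adj x y) :
    InPencil c.Adj l x y ↔ c.lower l = c.lower x ∧ c.upper x ⊓ c.upper y ≤ c.upper l ∧
      c.upper l ≤ c.upper x ⊔ c.upper y := by
  obtain ⟨t, d, hs, -, -, hthin⟩ := c.exists_isSheet_star hn x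
  have hxl := c.finrank_lower x
  have hxu := c.finrank_upper x
  by_cases ht : k + 3 ≤ finrank K t
  · exact hs.inPencil_iff_of_thick (by rw [rk_eq, rk_eq]; omega) rfl h.symm hne hxy
  -- The star is a projective plane.
  have hm := hthin.resolve_left ht
  have hyu := c.finrank_upper y
  have hall : ∀ n n', c.lower n = c.lower x → c.lower n' = c.lower x → c.Adj n n' := by
    intro n n' h1 h2
    refine (hs.adj_iff n h1 n' h2).2 ?_
    have h3 := (hs.slit n h1).2
    have h4 := (hs.slit n' h2).2
    have := rk_le_rk_inf h3.1 h4.1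
    have := h3.2.1
    have := h4.2.1
    have : rk t = finrank K t := rfl
    have : rk (c.lower x) = finrank K (c.lower x) := rfl
    omega
  have hthick : ¬ Thick c.Adj x y := by
    rintro ⟨n, n', h1, h2, h3, h4, h5⟩
    exact h5 (hall n n' (hs.closed x rfl y h.symm hne n h1 h2)
      (hs.closed x rfl y h.symm hne n' h3 h4))
  obtain ⟨-, U, hU, hUx, hUy⟩ := hxy
  have hinf := c.inf_eq_of_thru hne h hU hUx hUy
  constructor
  · rintro ⟨⟨h1, h2, -⟩, h3⟩
    have hl := hs.closed x rfl y h.symm hne l h1 h2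
    have hsup : c.upper x ⊔ c.upper y = t := by
      refine Submodule.eq_of_le_of_finrank_le
        (sup_le (hs.slit x rfl).2.1 (hs.slit y h.symm).2.1) ?_
      have := Submodule.finrank_sup_add_finrank_inf_eq (c.upper x) (c.upper y)
      rw [hinf] at this
      omega
    refine ⟨hl, ?_, hsup ▸ (hs.slit l hl).2.1⟩
    rcases h3 with h3 | rfl | rfl | ⟨m₁, m₂, m₃, h4, h5⟩
    · exact absurd h3 hthick
    · exact inf_le_left
    · exact inf_le_right
    · have h6 := c.thru_of_rect hn hk (fun _ _ => PAdj.adj) (fun _ _ h => h.1) h4 hU hUx hUy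
      obtain ⟨-, n1, -, s1, U', hU', hx', hl', hm'⟩ := c.exists_thru_of_rect hn hk
        (fun _ _ => PAdj.adj) (fun _ _ h => h.1) h5
      rw [hinf, c.thru_unique n1 s1 hU hU' hUx h6 hx' hm']
      exact hl'.2
  · rintro ⟨hl, h1, -⟩
    rw [hinf] at h1
    refine ⟨⟨hall _ _ hl rfl, hall _ _ hl h.symm, fun n hn1 hn2 =>
      hall _ _ (hs.closed x rfl y h.symm hne n hn1 hn2) hl⟩, ?_⟩
    by_cases hlx : l = x
    · exact Or.inr (Or.inl hlx)
    refine Or.inr (Or.inr (Or.inr ?_))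
    have hp : finrank K (U ⊓ W : Submodule K V) = m := by
      by_contra hp
      have := c.finrank_of_improper hU hUx hp
      omega
    -- Replacing the vertex of the star by a hyperplane `H` of `U` through `U ⊓ W` gives the
    -- opposite sides of the four-cycles.
    obtain ⟨H, hWH, hHU, hH⟩ := RankedLattice.exists_between (r := k - 1)
      (inf_le_left : U ⊓ W ≤ U) (by rw [rk_eq]; omega) (by rw [rk_eq]; omega)
    rw [rk_eq] at hH
    rw [inf_le_iff_finrank hHU, hp] at hWH
    have pair : ∀ n, c.lower n = c.lower x → U ≤ c.upper n →
        ∃ n', c.lower n' = H ∧ c.upper n' = c.upper n := by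
      intro n h2 h3
      have h4 := (c.isSpinePair n).2.2
      rw [h2] at h4
      exact c.surj _ _ ⟨hHU.trans h3, by omega, h4.1, by omega⟩
    obtain ⟨m₁, a1, b1⟩ := pair x rfl hUx.2
    obtain ⟨m₂, a2, b2⟩ := pair y h.symm hUy.2
    obtain ⟨m₃, a3, b3⟩ := pair l hl h1
    have hHx : c.lower m₁ ≠ c.lower x := fun h => by rw [← h, a1] at hm; omega
    exact ⟨m₁, m₂, m₃,
      c.rect_of_lower hn hk (fun _ _ => PAdj.adj) (fun _ _ h => h.1) h b2.symm (a2.trans a1.symm) b1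
        hHx (fun h' => hne (c.ext x y h h'.symm)),
      c.rect_of_lower hn hk (fun _ _ => PAdj.adj) (fun _ _ h => h.1) hl.symm b3.symm
        (a3.trans a1.symm) b1 hHx (fun h' => hlx (c.ext l x hl h'))⟩

theorem inPencil_iff_of_upper (hne : x ≠ y) (h : c.upper x = c.upper y) (hxy : c.Adj x y) :
    InPencil c.Adj l x y ↔ c.upper l = c.upper x ∧ c.lower l ≤ c.lower x ⊔ c.lower y ∧
      c.lower x ⊓ c.lower y ≤ c.lower l := by
  obtain ⟨t, d, hs, -, -, ht, -⟩ := c.exists_isSheet_top hn hk x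
  exact hs.inPencil_iff_of_thick ht rfl h.symm hne hxy

/-! ### Improper points -/

theorem finrank_ne_of_veblenFails (hV : VeblenFails c.Adj x y) (hU : finrank K U = k)
    (hx : c.Thru U x) (hy : c.Thru U y) : finrank K (U ⊓ W : Submodule K V) ≠ m := by
  have hV' := hV
  obtain ⟨-, -, -, ⟨hne, -⟩, ⟨hxy, -⟩, -⟩ := hV'
  rcases hxy.1 with h | h
  · obtain ⟨t, d, hs, -, hp, -⟩ := c.exists_isSheet_star hn x
    have h1 := hs.inf_le_of_veblenFails (fun a ha b hb hab hadj l => by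
      have := c.inPencil_iff_of_lower (l := l) hn hk hab (Eq.trans ha (Eq.symm hb)) hadj
      rwa [show c.lower a = c.lower x from ha] at this) rfl h.symm hV
    rw [c.inf_eq_of_thru hne h hU hx hy] at h1
    exact fun hm => ((hp U hx.1 hU).1 hm).2 h1
  · obtain ⟨t, d, hs, -, hp, -⟩ := c.exists_isSheet_top hn hk x
    have h1 : toDual (c.lower x ⊔ c.lower y) ≤ d :=
      hs.inf_le_of_veblenFails (fun a ha b hb hab hadj l => by
        have := c.inPencil_iff_of_upper (l := l) hn hk hab (Eq.trans ha (Eq.symm hb)) hadj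
        rwa [show c.upper a = c.upper x from ha] at this) rfl h.symm hV
    rw [c.sup_eq_of_thru hne h hU hx hy] at h1
    exact fun hm => ((hp U hx.2 hU).1 hm).2 h1

/-- At an improper point on a pencil of a star, the failure of the Veblen axiom is found in the top
of `x`, whose slit is never a single point. -/
theorem failsAcross_of_lower (hne : x ≠ y) (h : c.lower x = c.lower y) (hU : finrank K U = k)
    (hx : c.Thru U x) (hy : c.Thru U y) (him : finrank K (U ⊓ W : Submodule K V) ≠ m) :
    FailsAcross c.Adj x y := by
  obtain ⟨t, d, hs, -, hp, -, hd⟩ := c.exists_isSheet_top hn hk x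
  have hxu := c.finrank_upper x
  have hle := Submodule.finrank_le (c.upper x)
  have hUd : toDual U ≤ d := by
    by_contra hcon
    have h1 : toDual U ≤ t := le_trans (toDual_le_toDual.2 hx.1) (hs.slit x rfl).2.1
    exact him ((hp U hx.2 hU).2 ⟨h1, hcon⟩)
  have hd2 := hd.resolve_left fun he => by
    rw [he, toDual_le_toDual] at hUd
    have := Submodule.finrank_mono hUd
    omega
  obtain ⟨n, hnS, hxn, hUn, hV⟩ := hs.exists_veblenFails (fun a ha b hb hab hadj l => by
      have := c.inPencil_iff_of_upper (l := l) hn hk hab (Eq.trans ha (Eq.symm hb)) hadj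
      rwa [show c.upper a = c.upper x from ha] at this) rfl (u := toDual U)
    (toDual_le_toDual.2 hx.2) (by rw [rk_toDual, rk_toDual]; omega) (toDual_le_toDual.2 hx.1) hUd
    hd2
  have hnS : c.upper n = c.upper x := hnS
  have hUn : c.lower n ≤ U := hUn
  obtain ⟨n1, -, -⟩ := c.finrank_of_improper hU ⟨hUn, hnS ▸ hx.2⟩ him
  obtain ⟨-, y2, -⟩ := c.finrank_of_improper hU hy him
  obtain ⟨z, z1, z2⟩ := c.surj (c.lower n) (c.upper y) ⟨hUn.trans hy.2, c.finrank_lower n,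
    c.finrank_upper y, by omega⟩
  exact ⟨n, z, c.rect_of_lower hn hk (fun _ _ => PAdj.adj) (fun _ _ h => h.1) h z2.symm z1 hnS
    (fun h' => hxn (c.ext x n h'.symm hnS.symm)) (fun h' => hne (c.ext x y h h'.symm)), hV⟩

theorem improper_iff (hcodim : k + finrank K W ≤ m + finrank K V) (hne : x ≠ y)
    (hxy : c.Share x y) (hU : finrank K U = k) (hx : c.Thru U x) (hy : c.Thru U y) :
    Improper c.Adj x y ↔ finrank K (U ⊓ W : Submodule K V) ≠ m := by
  have across : ∀ {y}, FailsAcross c.Adj x y → c.Thru U y →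
      finrank K (U ⊓ W : Submodule K V) ≠ m := by
    rintro y ⟨n, z, h, hV⟩ hy
    have := c.thru_of_rect hn hk (fun _ _ => PAdj.adj) (fun _ _ h => h.1) h hU hx hy
    exact c.finrank_ne_of_veblenFails hn hk hV hU hx this
  constructor
  · rintro (h | ⟨n, z, h, hF⟩)
    · exact across h hy
    · exact across hF (c.thru_of_rect hn hk (fun _ _ => PAdj.adj) (fun _ _ h => h.1) h hU hx hy)
  · intro him
    rcases hxy with h | h
    · exact Or.inl (c.failsAcross_of_lower hn hk hne h hU hx hy him)
    · obtain ⟨z, w, hR⟩ := c.exists_rect_of_improper hn hk (fun _ _ => PAdj.adj) (fun _ _ h => h.1)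
        hcodim hne (Or.inr h) hU hx hy him
      obtain ⟨-, hxw, -, hs, -⟩ := c.exists_thru_of_rect hn hk (fun _ _ => PAdj.adj)
        (fun _ _ h => h.1) hR
      have hw := c.thru_of_rect hn hk (fun _ _ => PAdj.adj) (fun _ _ h => h.1) hR hU hx hy
      refine Or.inr ⟨w, z, hR, ?_⟩
      rcases hs with hs | hs
      · exact c.failsAcross_of_lower hn hk hxw hs hU hx hw him
      · have hyw := (c.rect_iff hn hk (fun _ _ => PAdj.adj) (fun _ _ h => h.1)).1 hR
        exact absurd (Or.inr (h.symm.trans hs)) hyw.2.2.2.2.2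

end LineCoords

end Coordinates

/-! ### Planes of point-line spaces -/

section PointLine

variable {P : Type*} {𝓛 : Set (Set P)} {X Y : Set P}

theorem subset_spClosure : X ⊆ spClosure 𝓛 X := Set.subset_sInter fun _ h => h.2

theorem spClosure_subset (hY : IsSubspace 𝓛 Y) (h : X ⊆ Y) : spClosure 𝓛 X ⊆ Y :=
  Set.sInter_subset_of_mem ⟨hY, h⟩

theorem isSubspace_spClosure : IsSubspace 𝓛 (spClosure 𝓛 X) := fun l hl hne =>
  Set.subset_sInter fun _ hY =>
    hY.1 l hl (hne.mono (Set.inter_subset_inter_right l (Set.sInter_subset_of_mem hY)))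

theorem spClosure_mono (h : X ⊆ Y) : spClosure 𝓛 X ⊆ spClosure 𝓛 Y :=
  spClosure_subset isSubspace_spClosure (h.trans subset_spClosure)

theorem spClosure_empty : spClosure 𝓛 (∅ : Set P) = ∅ :=
  Set.subset_empty_iff.1 (spClosure_subset (fun l _ h => by simp at h) subset_rfl)

/-- A plane contains a line and a point off it. -/
theorem IsPlane.exists_notMem (h : IsPlane 𝓛 X) :
    ∃ l ∈ 𝓛, l ⊆ X ∧ l.Nontrivial ∧ ∃ p ∈ X, p ∉ l := by
  obtain ⟨-, ⟨pp⟩⟩ := h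
  let := restrictMembership 𝓛 X
  obtain ⟨p₁, p₂, p₃, l₁, l₂, l₃, h1, -, -, h2, h3, -, h4, h5⟩ := pp.exists_config
  exact ⟨l₂.1, l₂.2.1, l₂.2.2, ⟨p₂.1, h2, p₃.1, h4, fun he => h5 (Subtype.ext he ▸ h3)⟩, p₁.1,
    p₁.2, h1⟩

/-- Two lines of a plane meet. -/
theorem IsPlane.exists_mem_inter (h : IsPlane 𝓛 X) {l l' : Set P} (hl : l ∈ 𝓛) (hlX : l ⊆ X)
    (hl' : l' ∈ 𝓛) (hlX' : l' ⊆ X) (hne : l ≠ l') : ∃ p, p ∈ l ∧ p ∈ l' := by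
  obtain ⟨-, ⟨pp⟩⟩ := h
  let := restrictMembership 𝓛 X
  have hne : (⟨l, hl, hlX⟩ : {l : Set P // l ∈ 𝓛 ∧ l ⊆ X}) ≠ ⟨l', hl', hlX'⟩ :=
    fun he => hne (congrArg Subtype.val he)
  exact ⟨_, pp.mkPoint_ax hne⟩

/-- A set of points whose geometry is that of an interval of length three of a ranked lattice is a
plane. -/
theorem isPlane_of_lattice {Λ : Type*} [Lattice Λ] [RankedLattice Λ] (e : P → Λ)
    (he : Function.Injective e) {a y : Λ} (hay : a ≤ y) (hy : rk y = rk a + 3)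
    (hX : ∀ p, p ∈ X ↔ a ≤ e p ∧ e p ≤ y) (hr : ∀ p, rk (e p) = rk a + 1)
    (hsurj : ∀ u, a ≤ u → u ≤ y → rk u = rk a + 1 → ∃ p, e p = u)
    (hl : ∀ l, (l ∈ 𝓛 ∧ l ⊆ X) ↔
      ∃ b, a ≤ b ∧ b ≤ y ∧ rk b = rk a + 2 ∧ l = {p | a ≤ e p ∧ e p ≤ b})
    (hsub : IsSubspace 𝓛 X) : IsPlane 𝓛 X := by
  have join : ∀ p ∈ X, ∀ q ∈ X, p ≠ q → ∃ l, (l ∈ 𝓛 ∧ l ⊆ X) ∧ p ∈ l ∧ q ∈ l := by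
    intro p hp q hq hpq
    rw [hX] at hp hq
    exact ⟨_, (hl _).2 ⟨e p ⊔ e q, hp.1.trans le_sup_left, sup_le hp.2 hq.2,
      rk_sup_of_ne hp.1 hq.1 (hr p) (hr q) (fun h => hpq (he h)), rfl⟩, ⟨hp.1, le_sup_left⟩,
      ⟨hq.1, le_sup_right⟩⟩
  have unique : ∀ p q : P, ∀ l l', (l ∈ 𝓛 ∧ l ⊆ X) → (l' ∈ 𝓛 ∧ l' ⊆ X) → p ∈ l → q ∈ l →
      p ∈ l' → q ∈ l' → p = q ∨ l = l' := by
    intro p q l l' h h' hp hq hp' hq'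
    obtain ⟨b, -, -, hb, rfl⟩ := (hl l).1 h
    obtain ⟨b', -, -, hb', rfl⟩ := (hl l').1 h'
    by_cases hpq : p = q
    · exact Or.inl hpq
    right
    rw [← eq_sup_of_ne hp.1 hq.1 (hr p) (hr q) (fun h => hpq (he h)) hp.2 hq.2 hb,
      ← eq_sup_of_ne hp.1 hq.1 (hr p) (hr q) (fun h => hpq (he h)) hp'.2 hq'.2 hb']
  have meet : ∀ l l', (l ∈ 𝓛 ∧ l ⊆ X) → (l' ∈ 𝓛 ∧ l' ⊆ X) → ∃ p ∈ X, p ∈ l ∧ p ∈ l' := by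
    intro l l' h h'
    obtain ⟨b, hb, hby, hbr, rfl⟩ := (hl l).1 h
    obtain ⟨b', hb', hby', hbr', rfl⟩ := (hl l').1 h'
    have := rk_le_rk_inf hby hby'
    obtain ⟨u, h1, h2, h3⟩ := exists_between (r := rk a + 1) (le_inf hb hb') (by omega) (by omega)
    obtain ⟨p, rfl⟩ := hsurj u h1 (h2.trans (inf_le_left.trans hby)) h3
    exact ⟨p, (hX p).2 ⟨h1, h2.trans (inf_le_left.trans hby)⟩, ⟨h1, h2.trans inf_le_left⟩,
      ⟨h1, h2.trans inf_le_right⟩⟩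
  obtain ⟨p₁, p₂, p₃, l₁, l₂, l₃, ⟨⟨a1, b1, c1⟩, ⟨a2, b2, c2⟩, ⟨a3, b3, c3⟩⟩, ⟨⟨d1, e1, f1⟩,
    ⟨d2, e2, f2⟩, ⟨d3, e3, f3⟩⟩, h12, h13, h21, h22, h23, h31, h32, h33⟩ := exists_config hay hy
  obtain ⟨p₁, rfl⟩ := hsurj p₁ a1 b1 c1
  obtain ⟨p₂, rfl⟩ := hsurj p₂ a2 b2 c2
  obtain ⟨p₃, rfl⟩ := hsurj p₃ a3 b3 c3
  let := restrictMembership 𝓛 X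
  let q₁ : X := ⟨p₁, (hX _).2 ⟨a1, b1⟩⟩
  let q₂ : X := ⟨p₂, (hX _).2 ⟨a2, b2⟩⟩
  let q₃ : X := ⟨p₃, (hX _).2 ⟨a3, b3⟩⟩
  let m₁ : {l : Set P // l ∈ 𝓛 ∧ l ⊆ X} := ⟨_, (hl _).2 ⟨l₁, d1, e1, f1, rfl⟩⟩
  let m₂ : {l : Set P // l ∈ 𝓛 ∧ l ⊆ X} := ⟨_, (hl _).2 ⟨l₂, d2, e2, f2, rfl⟩⟩
  let m₃ : {l : Set P // l ∈ 𝓛 ∧ l ⊆ X} := ⟨_, (hl _).2 ⟨l₃, d3, e3, f3, rfl⟩⟩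
  have i12 : q₁ ∉ m₂ := fun h => h12 h.2
  have i13 : q₁ ∉ m₃ := fun h => h13 h.2
  have i21 : q₂ ∉ m₁ := fun h => h21 h.2
  have i22 : q₂ ∈ m₂ := ⟨a2, h22⟩
  have i23 : q₂ ∈ m₃ := ⟨a2, h23⟩
  have i31 : q₃ ∉ m₁ := fun h => h31 h.2
  have i32 : q₃ ∈ m₂ := ⟨a3, h32⟩
  have i33 : q₃ ∉ m₃ := fun h => h33 h.2
  have uniq : ∀ {p q : X} {l l' : {l : Set P // l ∈ 𝓛 ∧ l ⊆ X}}, p ∈ l → q ∈ l → p ∈ l' → q ∈ l' →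
      p = q ∨ l = l' := fun {p q l l'} h1 h2 h3 h4 =>
    (unique p q l l' l.2 l'.2 h1 h2 h3 h4).imp Subtype.ext Subtype.ext
  have : Nonempty P := ⟨p₁⟩
  choose! f hf using join
  choose! g hg using meet
  refine ⟨⟨hsub, fun p hp q hq hpq => ⟨f p q, (hf p hp q hq hpq).1.1, (hf p hp q hq hpq).2⟩⟩,
    ⟨{ exists_point := fun l => ?_
       exists_line := fun p => ?_
       eq_or_eq := uniq
       mkPoint := fun {l l'} _ => ⟨g l l', (hg l l' l.2 l'.2).1⟩
       mkPoint_ax := fun {l l'} _ => (hg l l' l.2 l'.2).2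
       mkLine := fun {p q} h => ⟨f p q, (hf p p.2 q q.2 (fun h' => h (Subtype.ext h'))).1⟩
       mkLine_ax := fun {p q} h => (hf p p.2 q q.2 (fun h' => h (Subtype.ext h'))).2
       exists_config := ⟨q₁, q₂, q₃, m₁, m₂, m₃, i12, i13, i21, i22, i23, i31, i32, i33⟩ }⟩⟩
  · by_contra! hcon
    rcases uniq (hcon q₂) (hcon q₃) i22 i32 with h | h
    · exact i33 (h ▸ i23)
    · exact i12 (h ▸ hcon q₁)
  · by_contra! hcon
    rcases uniq (hcon m₂) i22 (hcon m₃) i23 with h | h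
    · exact i21 (h ▸ hcon m₁)
    · exact i33 (h ▸ i32)

end PointLine

/-! ### Planes of Grassmann spaces -/

section Grassmann

variable {K V : Type*} [DivisionRing K] [AddCommGroup V] [Module K V] {k : ℕ}

variable (k) in
/-- The interval of all `k`-dimensional subspaces between `Z` and `Y`. -/
def grassIcc (Z Y : Submodule K V) : Set (Grass K V k) := {U | Z ≤ U.1 ∧ U.1 ≤ Y}

variable {H B Z Y : Submodule K V} {U U' : Grass K V k}

theorem grassIcc_mem (hHB : H ≤ B) (hH : finrank K H + 1 = k) (hB : finrank K B = k + 1) :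
    grassIcc k H B ∈ grassLines K V k := ⟨H, B, hH, hB, hHB, rfl⟩

variable [FiniteDimensional K V]

theorem inf_eq_and_sup_eq (hH : finrank K H + 1 = k) (hB : finrank K B = k + 1)
    (hU : U ∈ grassIcc k H B) (hU' : U' ∈ grassIcc k H B) (hne : U ≠ U') :
    U.1 ⊓ U'.1 = H ∧ U.1 ⊔ U'.1 = B := by
  have hne : U.1 ≠ U'.1 := fun h => hne (Subtype.ext h)
  have r := U.2
  have r' := U'.2
  exact ⟨eq_inf_of_ne (b := B) (by rw [rk_eq, rk_eq]; omega) (by rw [rk_eq, rk_eq]; omega) hne hU.1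
      hU'.1 (by rw [rk_eq, rk_eq]; omega),
    eq_sup_of_ne hU.1 hU'.1 (by rw [rk_eq, rk_eq]; omega) (by rw [rk_eq, rk_eq]; omega) hne hU.2
      hU'.2 (by rw [rk_eq, rk_eq]; omega)⟩

theorem grassIcc_nontrivial (hHB : H ≤ B) (hH : finrank K H + 1 = k) (hB : finrank K B = k + 1) :
    (grassIcc k H B).Nontrivial := by
  obtain ⟨p, q, hne, ⟨h1, h2, h3, -⟩, ⟨h4, h5, h6, -⟩⟩ := (isSlitLine_iff_exists_two (t := B)
    (d := H) le_rfl hHB (by rw [rk_eq, rk_eq]; omega)).1 ⟨hHB, le_rfl, by rw [rk_eq, rk_eq]; omega,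
      fun h => by have := Submodule.finrank_mono h; omega⟩
  rw [rk_eq, rk_eq] at h3 h6
  exact ⟨⟨p, by omega⟩, ⟨h1, h2⟩, ⟨q, by omega⟩, ⟨h4, h5⟩, fun h => hne (congrArg Subtype.val h)⟩

theorem le_and_le_of_grassIcc_subset (hHB : H ≤ B) (hH : finrank K H + 1 = k)
    (hB : finrank K B = k + 1) (h : grassIcc k H B ⊆ grassIcc k Z Y) : Z ≤ H ∧ B ≤ Y := by
  obtain ⟨U, hU, U', hU', hne⟩ := grassIcc_nontrivial hHB hH hB
  obtain ⟨h1, h2⟩ := inf_eq_and_sup_eq hH hB hU hU' hne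
  exact ⟨h1 ▸ le_inf (h hU).1 (h hU').1, h2 ▸ sup_le (h hU).2 (h hU').2⟩

theorem isSubspace_grassIcc : IsSubspace (grassLines K V k) (grassIcc k Z Y) := by
  rintro l ⟨H, B, hH, hB, hHB, rfl⟩ ⟨U, hU, U', hU', hne⟩
  obtain ⟨h1, h2⟩ := inf_eq_and_sup_eq hH hB hU.1 hU'.1 hne
  exact fun T hT => ⟨(h1 ▸ le_inf hU.2.1 hU'.2.1 : Z ≤ H).trans hT.1,
    hT.2.trans (h2 ▸ sup_le hU.2.2 hU'.2.2 : B ≤ Y)⟩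

theorem isPlane_grassIcc_star (hHY : H ≤ Y) (hH : finrank K H + 1 = k) (hY : finrank K Y = k + 2) :
    IsPlane (grassLines K V k) (grassIcc k H Y) := by
  refine isPlane_of_lattice (fun U : Grass K V k => U.1) Subtype.val_injective hHY
    (by rw [rk_eq, rk_eq]; omega) (fun _ => Iff.rfl)
    (fun p => by have := p.2; rw [rk_eq, rk_eq]; omega)
    (fun u _ _ h3 => ⟨⟨u, by rw [rk_eq, rk_eq] at h3; omega⟩, rfl⟩) (fun l => ⟨?_, ?_⟩)
    isSubspace_grassIcc
  · rintro ⟨⟨H', B, hH', hB, hHB, rfl⟩, hsub⟩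
    obtain ⟨h1, h2⟩ := le_and_le_of_grassIcc_subset hHB hH' hB hsub
    obtain rfl := Submodule.eq_of_le_of_finrank_eq h1 (by omega)
    exact ⟨B, hHB, h2, by rw [rk_eq, rk_eq]; omega, rfl⟩
  · rintro ⟨b, h1, h2, h3, rfl⟩
    rw [rk_eq, rk_eq] at h3
    exact ⟨⟨H, b, hH, by omega, h1, rfl⟩, fun T hT => ⟨hT.1, hT.2.trans h2⟩⟩

theorem isPlane_grassIcc_top (hZB : Z ≤ B) (hZ : finrank K Z + 2 = k) (hB : finrank K B = k + 1) :
    IsPlane (grassLines K V k) (grassIcc k Z B) := by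
  have hle : ∀ U : Submodule K V, finrank K U ≤ finrank K V := Submodule.finrank_le
  have hBV := hle B
  refine isPlane_of_lattice (fun U : Grass K V k => toDual U.1)
    (fun _ _ h => Subtype.ext h) (toDual_le_toDual.2 hZB)
    (by rw [rk_toDual, rk_toDual]; omega) (fun _ => and_comm)
    (fun p => by have := p.2; rw [rk_toDual, rk_toDual]; omega)
    (fun u _ _ h3 => ?_) (fun l => ⟨?_, ?_⟩) isSubspace_grassIcc
  · have h3 : finrank K V - finrank K (ofDual u : Submodule K V) =
      finrank K V - finrank K B + 1 := h3
    have := hle (ofDual u)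
    exact ⟨⟨ofDual u, by omega⟩, rfl⟩
  · rintro ⟨⟨H', B', hH', hB', hHB, rfl⟩, hsub⟩
    obtain ⟨h1, h2⟩ := le_and_le_of_grassIcc_subset hHB hH' hB' hsub
    obtain rfl := Submodule.eq_of_le_of_finrank_eq h2 (by omega)
    exact ⟨toDual H', hHB, h1, by rw [rk_toDual, rk_toDual]; omega,
      Set.ext fun U => and_comm⟩
  · rintro ⟨b, h1, h2, h3, rfl⟩
    have h3 : finrank K V - finrank K (ofDual b : Submodule K V) =
      finrank K V - finrank K B + 2 := h3
    have := hle (ofDual b)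
    exact ⟨⟨ofDual b, B, by omega, hB, h1, Set.ext fun U => and_comm⟩,
      fun T hT => ⟨le_trans (α := Submodule K V) h2 hT.2, hT.1⟩⟩

/-- The planes of a Grassmann space are intervals of length three in a star or in a top. -/
theorem IsPlane.exists_grassIcc {X : Set (Grass K V k)} (h : IsPlane (grassLines K V k) X) :
    ∃ Z Y : Submodule K V, Z ≤ Y ∧ X = grassIcc k Z Y ∧
      ((finrank K Z + 1 = k ∧ finrank K Y = k + 2) ∨
        (finrank K Z + 2 = k ∧ finrank K Y = k + 1)) := by
  obtain ⟨l, hl, hlX, hnt, p, hpX, hpl⟩ := h.exists_notMem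
  -- Each point of `X` is on a line that joins `p` to a point of `l`.
  have hline : ∀ q ∈ X, q ≠ p → ∃ g ∈ grassLines K V k, g ⊆ X ∧ p ∈ g ∧ q ∈ g ∧
      ∃ r ∈ l, r ∈ g ∧ r ≠ p := by
    intro q hq hqp
    obtain ⟨g, hg, h1, h2⟩ := h.1.2 p hpX q hq hqp.symm
    have hgX := h.1.1 g hg ⟨p, ⟨h1, hpX⟩, q, ⟨h2, hq⟩, hqp.symm⟩
    obtain ⟨r, hr, hr'⟩ := h.exists_mem_inter hl hlX hg hgX (fun he => hpl (he ▸ h1))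
    exact ⟨g, hg, hgX, h1, h2, r, hr, hr', fun he => hpl (he ▸ hr)⟩
  have hsub : ∀ Z Y : Submodule K V, p ∈ grassIcc k Z Y → l ⊆ grassIcc k Z Y →
      X ⊆ grassIcc k Z Y := by
    intro Z Y hp hlI q hq
    by_cases hqp : q = p
    · exact hqp ▸ hp
    obtain ⟨g, hg, -, h1, h2, r, hr, hr', hrp⟩ := hline q hq hqp
    exact isSubspace_grassIcc g hg ⟨p, ⟨h1, hp⟩, r, ⟨hr', hlI hr⟩, hrp.symm⟩ h2
  obtain ⟨H, B, hH, hB, hHB, rfl⟩ := hl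
  have hp : finrank K p.1 = k := p.2
  obtain ⟨U, hU, U', hU', hne⟩ := hnt
  obtain ⟨hinf, hsup⟩ := inf_eq_and_sup_eq hH hB hU hU' hne
  have coll : ∀ q : Grass K V k, q ∈ X → q ≠ p → k ≤ rk (p.1 ⊓ q.1) + 1 := by
    intro q hq hqp
    obtain ⟨g, ⟨H', B', hH', -, -, rfl⟩, -, h1, h2, -⟩ := hline q hq hqp
    have := Submodule.finrank_mono (le_inf h1.1 h2.1)
    rw [rk_eq]
    omega
  have hUp : U ≠ p := fun h => hpl (h ▸ hU)
  have hUp' : U' ≠ p := fun h => hpl (h ▸ hU')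
  -- `p` is collinear with two points of `l`, so it is in the star or in the top of `l`.
  have htri : H ≤ p.1 ∨ p.1 ≤ B := by
    have hc1 := coll U (hlX hU) hUp
    have hc2 := coll U' (hlX hU') hUp'
    by_cases hk : 2 ≤ k
    · have := inf_le_or_le_sup (a := U.1) (b := U'.1) (c := p.1) (r := k - 2)
        (by rw [rk_eq]; omega) (by rw [hinf, rk_eq]; omega) (by omega) (by omega)
      rwa [hinf, hsup] at this
    · left
      have : finrank K H = 0 := by omega
      rw [Submodule.finrank_eq_zero.1 this]
      exact bot_le
  rcases htri with hHp | hpB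
  · have hpB : ¬ p.1 ≤ B := fun h => hpl ⟨hHp, h⟩
    have hinfr : finrank K (p.1 ⊓ B : Submodule K V) + 1 = k := by
      have h1 := rk_inf_lt hpB
      have h2 := Submodule.finrank_mono (le_inf hHp hHB)
      rw [rk_eq, rk_eq] at h1
      omega
    have hs := Submodule.finrank_sup_add_finrank_inf_eq p.1 B
    refine ⟨H, p.1 ⊔ B, hHp.trans le_sup_left, ?_, Or.inl ⟨hH, by omega⟩⟩
    refine (hsub H (p.1 ⊔ B) ⟨hHp, le_sup_left⟩
      fun T hT => ⟨hT.1, hT.2.trans le_sup_right⟩).antisymm fun T hT => ?_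
    by_cases hTp : T = p
    · exact hTp ▸ hpX
    have hTr : finrank K T.1 = k := T.2
    have hj := rk_sup_of_ne (u := p.1) (v := T.1) hHp hT.1 (by rw [rk_eq, rk_eq]; omega)
      (by rw [rk_eq, rk_eq]; omega) (fun h => hTp (Subtype.ext h.symm))
    have hm := rk_le_rk_inf (sup_le le_sup_left hT.2 : p.1 ⊔ T.1 ≤ p.1 ⊔ B)
      (le_sup_right : B ≤ p.1 ⊔ B)
    simp only [rk_eq] at hj hm
    obtain ⟨R, hR1, hR2, hR3⟩ := exists_between (r := k)
      (le_inf (hHp.trans le_sup_left) hHB : H ≤ (p.1 ⊔ T.1) ⊓ B) (by rw [rk_eq]; omega)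
      (by rw [rk_eq]; omega)
    let R' : Grass K V k := ⟨R, hR3⟩
    have hRX : R' ∈ X := hlX ⟨hR1, hR2.trans inf_le_right⟩
    refine h.1.1 (grassIcc k H (p.1 ⊔ T.1)) (grassIcc_mem (hHp.trans le_sup_left) hH (by omega))
      ⟨p, ⟨⟨hHp, le_sup_left⟩, hpX⟩, R', ⟨⟨hR1, hR2.trans inf_le_left⟩, hRX⟩, fun he => ?_⟩
      ⟨hT.1, le_sup_right⟩
    exact hpB (he ▸ hR2.trans inf_le_right)
  · have hHp : ¬ H ≤ p.1 := fun h => hpl ⟨h, hpB⟩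
    have hc1 := coll U (hlX hU) hUp
    have hsupr : finrank K (H ⊔ p.1 : Submodule K V) = k + 1 := by
      have h1 : ¬ H ⊔ p.1 ≤ p.1 := fun h => hHp (le_sup_left.trans h)
      have h2 := rk_inf_lt h1
      have h3 := Submodule.finrank_mono (sup_le hHB hpB)
      rw [inf_eq_right.2 le_sup_right, rk_eq, rk_eq] at h2
      omega
    have hs := Submodule.finrank_sup_add_finrank_inf_eq H p.1
    refine ⟨H ⊓ p.1, B, inf_le_right.trans hpB, ?_, Or.inr ⟨by omega, hB⟩⟩
    refine (hsub (H ⊓ p.1) B ⟨inf_le_right, hpB⟩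
      fun T hT => ⟨inf_le_left.trans hT.1, hT.2⟩).antisymm fun T hT => ?_
    by_cases hTp : T = p
    · exact hTp ▸ hpX
    have hTr : finrank K T.1 = k := T.2
    have hne : p.1 ≠ T.1 := fun h => hTp (Subtype.ext h.symm)
    have hlt : ¬ p.1 ≤ T.1 := fun h => hne (Submodule.eq_of_le_of_finrank_eq h (by omega))
    have hi := rk_inf_lt hlt
    have hsB := Submodule.finrank_mono (sup_le hpB hT.2)
    have hst := Submodule.finrank_sup_add_finrank_inf_eq p.1 T.1
    have hi2 := Submodule.finrank_sup_add_finrank_inf_eq (p.1 ⊓ T.1) H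
    have hi3 := Submodule.finrank_mono (le_inf (le_inf inf_le_right hT.1) inf_le_left :
      H ⊓ p.1 ≤ (p.1 ⊓ T.1) ⊓ H)
    rw [rk_eq, rk_eq] at hi
    have hle : (p.1 ⊓ T.1) ⊔ H ≤ B := sup_le (inf_le_left.trans hpB) hHB
    obtain ⟨R, hR1, hR2, hR3⟩ := exists_between (r := k) hle (by rw [rk_eq]; omega)
      (by rw [rk_eq]; omega)
    let R' : Grass K V k := ⟨R, hR3⟩
    have hRX : R' ∈ X := hlX ⟨le_sup_right.trans hR1, hR2⟩
    refine h.1.1 (grassIcc k (p.1 ⊓ T.1) B) (grassIcc_mem (inf_le_left.trans hpB) (by omega) hB)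
      ⟨p, ⟨⟨inf_le_left, hpB⟩, hpX⟩, R', ⟨⟨le_sup_left.trans hR1, hR2⟩, hRX⟩, fun he => ?_⟩
      ⟨inf_le_right, hT.2⟩
    exact hHp (he ▸ le_sup_right.trans hR1)

end Grassmann

/-! ### The lines, planes and pencils of the spine space -/

section Spine

variable {K V : Type*} [DivisionRing K] [AddCommGroup V] [Module K V] [FiniteDimensional K V]
  {W : Submodule K V} {k m : ℕ}

/-- The pairs `(H, B)` with a type that is allowed in `IsSpinePair` are exactly those with at least
two proper points in between. -/
theorem isSpinePair_iff_nontrivial (hn : k + 3 ≤ finrank K V) {H B : Submodule K V} (hHB : H ≤ B)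
    (hH : finrank K H + 1 = k) (hB : finrank K B = k + 1) :
    IsSpinePair W k m H B ↔ (grassIcc k H B ∩ spinePoints k m W).Nontrivial := by
  have key : (finrank K (H ⊓ W : Submodule K V) = m ∨
      finrank K (H ⊓ W : Submodule K V) + 1 = m) →
      (IsSpinePair W k m H B ↔ (grassIcc k H B ∩ spinePoints k m W).Nontrivial) := by
    intro hm
    obtain ⟨t, d, hHd, -, hU, hpair, -⟩ := exists_slit_star (W := W) (m := m) hn hH hm
    have hs := isSlitLine_iff_exists_two (t := t) hHd hHB (by rw [rk_eq, rk_eq]; omega)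
    have hs' : IsSlitLine H t d B ↔ B ≤ t ∧ ¬ B ≤ d :=
      ⟨fun h => ⟨h.2.1, h.2.2.2⟩, fun h => ⟨hHB, h.1, by rw [rk_eq, rk_eq]; omega, h.2⟩⟩
    rw [hpair B hHB hB, ← hs', hs]
    constructor
    · rintro ⟨u, v, hne, ⟨h1, h2, h3, h4⟩, ⟨h5, h6, h7, h8⟩⟩
      rw [rk_eq, rk_eq, hH] at h3 h7
      exact ⟨⟨u, h3⟩, ⟨⟨h1, h2⟩, (hU u h1 h3).2 h4⟩, ⟨v, h7⟩, ⟨⟨h5, h6⟩, (hU v h5 h7).2 h8⟩,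
        fun h => hne (congrArg Subtype.val h)⟩
    · rintro ⟨u, ⟨h1, h2⟩, v, ⟨h3, h4⟩, hne⟩
      exact ⟨u.1, v.1, fun h => hne (Subtype.ext h),
        ⟨h1.1, h1.2, by rw [rk_eq, rk_eq, hH]; exact u.2, (hU u.1 h1.1 u.2).1 h2⟩,
        ⟨h3.1, h3.2, by rw [rk_eq, rk_eq, hH]; exact v.2, (hU v.1 h3.1 v.2).1 h4⟩⟩
  constructor
  · intro h
    exact (key (by have := h.2.2.2; omega)).1 h
  · intro h
    have hnt := h
    obtain ⟨u, ⟨h1, h2⟩, -⟩ := h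
    have h3 := finrank_inf_mono (W := W) h1.1
    have h4 : finrank K (u.1 ⊓ W : Submodule K V) = m := h2
    have h5 := u.2
    exact (key (by omega)).2 hnt

theorem spClosure_trace {H B : Submodule K V} (hHB : H ≤ B) (hH : finrank K H + 1 = k)
    (hB : finrank K B = k + 1) {S : Set (Grass K V k)} (h : (grassIcc k H B ∩ S).Nontrivial) :
    spClosure (grassLines K V k) (grassIcc k H B ∩ S) = grassIcc k H B := by
  refine (spClosure_subset isSubspace_grassIcc Set.inter_subset_left).antisymm ?_
  exact isSubspace_spClosure _ (grassIcc_mem hHB hH hB)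
    (h.mono (Set.subset_inter Set.inter_subset_left subset_spClosure))

/-- A line of the spine space is the trace of a unique line of the Grassmann space, its closure. -/
theorem exists_spineCoords (hn : k + 3 ≤ finrank K V) :
    ∃ c : LineCoords W k m (SpineLine k m W),
      ∀ l, l.1 = grassIcc k (c.lower l) (c.upper l) ∩ spinePoints k m W ∧
        spClosure (grassLines K V k) l.1 = grassIcc k (c.lower l) (c.upper l) := by
  have hex : ∀ l : SpineLine k m W, ∃ p : Submodule K V × Submodule K V,
      IsSpinePair W k m p.1 p.2 ∧ l.1 = grassIcc k p.1 p.2 ∩ spinePoints k m W := by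
    rintro ⟨l, g, ⟨H, B, hH, hB, hHB, rfl⟩, rfl, hnt⟩
    exact ⟨(H, B), (isSpinePair_iff_nontrivial hn hHB hH hB).2 hnt, rfl⟩
  choose p hp hpl using hex
  have hnt : ∀ l, (grassIcc k (p l).1 (p l).2 ∩ spinePoints k m W).Nontrivial := fun l =>
    (isSpinePair_iff_nontrivial hn (hp l).1 (hp l).2.1 (hp l).2.2.1).1 (hp l)
  refine ⟨⟨fun l => (p l).1, fun l => (p l).2, hp, fun l l' h1 h2 => Subtype.ext ?_,
    fun H B h => ?_⟩, fun l => ⟨hpl l, ?_⟩⟩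
  · rw [hpl, hpl, h1, h2]
  · have hnt' := (isSpinePair_iff_nontrivial hn h.1 h.2.1 h.2.2.1).1 h
    let l : SpineLine k m W := ⟨_, _, grassIcc_mem h.1 h.2.1 h.2.2.1, rfl, hnt'⟩
    obtain ⟨u, hu, v, hv, hne⟩ := hnt'
    have hl : l.1 = grassIcc k H B ∩ spinePoints k m W := rfl
    have hu' : u ∈ l.1 := hu
    have hv' : v ∈ l.1 := hv
    rw [hpl] at hu' hv'
    obtain ⟨h1, h2⟩ := inf_eq_and_sup_eq h.2.1 h.2.2.1 hu.1 hv.1 hne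
    obtain ⟨h3, h4⟩ := inf_eq_and_sup_eq (hp l).2.1 (hp l).2.2.1 hu'.1 hv'.1 hne
    exact ⟨l, h3.symm.trans h1, h4.symm.trans h2⟩
  · rw [hpl]
    exact spClosure_trace (hp l).1 (hp l).2.1 (hp l).2.2.1 (hnt l)

variable (c : LineCoords W k m (SpineLine k m W))

/-- Every point of the closure of a plane of the spine space is on two lines of the plane. -/
theorem exists_two_lines_of_plane (hn : k + 3 ≤ finrank K V) (hk : m + 3 ≤ k)
    {E : Set (Grass K V k)}
    (hE : IsFragmentPlane (grassLines K V k) (spinePoints k m W) E) :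
    ∃ Z Y, spClosure (grassLines K V k) E = grassIcc k Z Y ∧
      ((finrank K Z + 1 = k ∧ finrank K Y = k + 2) ∨
        (finrank K Z + 2 = k ∧ finrank K Y = k + 1)) ∧
      ∀ U ∈ grassIcc k Z Y, ∃ x y, x ≠ y ∧ c.Share x y ∧ c.Thru U.1 x ∧ c.Thru U.1 y ∧
        (Z ≤ c.lower x ∧ c.upper x ≤ Y) ∧ (Z ≤ c.lower y ∧ c.upper y ≤ Y) := by
  obtain ⟨hES, -, hpl⟩ := hE
  obtain ⟨Z, Y, hZY, hcl, hr⟩ := hpl.exists_grassIcc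
  refine ⟨Z, Y, hcl, hr, fun U hU => ?_⟩
  have hEI : E ⊆ grassIcc k Z Y := hcl ▸ subset_spClosure
  have hne : E.Nonempty := by
    by_contra h
    rw [Set.not_nonempty_iff_eq_empty.1 h, spClosure_empty] at hcl
    rw [← hcl] at hU
    exact hU
  obtain ⟨T, hT⟩ := hne
  have hTr := T.2
  have hUr := U.2
  have hTm : finrank K (T.1 ⊓ W : Submodule K V) = m := hES hT
  obtain ⟨hZT, hTY⟩ := hEI hT
  rcases hr with ⟨hZ, hY⟩ | ⟨hZ, hY⟩
  · -- A subspace through all points of the plane contains `Y`.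
    have hjoin : ∀ C : Submodule K V, (∀ T ∈ E, T.1 ≤ C) → Y ≤ C := by
      intro C hC
      have h1 : grassIcc k Z Y ⊆ grassIcc k Z C :=
        hcl ▸ spClosure_subset isSubspace_grassIcc fun T hT => ⟨(hEI hT).1, hC T hT⟩
      by_contra hYC
      obtain ⟨p, h2, h3, h4, -, h5⟩ := exists_atom hZY le_rfl
        (fun h => by have := Submodule.finrank_mono h; omega) hYC
      rw [rk_eq, rk_eq, hZ] at h4
      exact h5 (h1 (show (⟨p, h4⟩ : Grass K V k) ∈ _ from ⟨h2, h3⟩)).2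
    have hm := finrank_inf_mono (W := W) hZT
    obtain ⟨t, d, -, -, hp, hpair, -⟩ := exists_slit_star (W := W) (m := m) hn hZ (by omega)
    obtain ⟨b₁, b₂, hb, ⟨h1, h1', h1''⟩, ⟨h2, h2', h2''⟩⟩ := exists_two_slitLines (t := t) (d := d)
      hU.1 (by rw [rk_eq, rk_eq]; omega) hU.2 (by rw [rk_eq, rk_eq]; omega)
      (hjoin t fun T hT => ((hp T.1 (hEI hT).1 T.2).1 (hES hT)).1)
      (fun h => ((hp T.1 hZT hTr).1 hTm).2 (hTY.trans h))
    have r1 := h1.2.2.1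
    have r2 := h2.2.2.1
    rw [rk_eq, rk_eq] at r1 r2
    obtain ⟨x, x1, x2⟩ := c.surj Z b₁ ((hpair b₁ h1.1 (by omega)).2 ⟨h1.2.1, h1.2.2.2⟩)
    obtain ⟨y, y1, y2⟩ := c.surj Z b₂ ((hpair b₂ h2.1 (by omega)).2 ⟨h2.2.1, h2.2.2.2⟩)
    exact ⟨x, y, fun h => hb (by rw [← x2, ← y2, h]), Or.inl (x1.trans y1.symm),
      ⟨x1 ▸ hU.1, x2 ▸ h1'⟩, ⟨y1 ▸ hU.1, y2 ▸ h2'⟩, ⟨x1.ge, x2 ▸ h1''⟩, ⟨y1.ge, y2 ▸ h2''⟩⟩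
  · have hle : ∀ U : Submodule K V, finrank K U ≤ finrank K V := Submodule.finrank_le
    have hYV := hle Y
    -- A subspace of all points of the plane is contained in `Z`.
    have hjoin : ∀ C : Submodule K V, (∀ T ∈ E, C ≤ T.1) → C ≤ Z := by
      intro C hC
      have h1 : grassIcc k Z Y ⊆ grassIcc k C Y :=
        hcl ▸ spClosure_subset isSubspace_grassIcc fun T hT => ⟨hC T hT, (hEI hT).2⟩
      by_contra hYC
      obtain ⟨p, h2, h3, h4, -, h5⟩ := exists_hyperplane_not_le (x := Y) (y := C) hZY le_rfl
        (fun h => by have := Submodule.finrank_mono h; omega) hYC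
      exact h5 (h1 (show (⟨p, by omega⟩ : Grass K V k) ∈ _ from ⟨h2, h3⟩)).1
    have hm := finrank_inf_mono (W := W) hTY
    obtain ⟨t, d, -, -, hp, hpair, -⟩ := exists_slit_top (W := W) (m := m) hn hk hY (by omega)
    obtain ⟨b₁, b₂, hb, ⟨h1, h1', h1''⟩, ⟨h2, h2', h2''⟩⟩ := exists_two_slitLines (t := t) (d := d)
      (toDual_le_toDual.2 hU.2) (by rw [rk_toDual, rk_toDual]; omega) (toDual_le_toDual.2 hU.1)
      (by rw [rk_toDual, rk_toDual]; omega)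
      (hjoin (ofDual t) fun T hT => ((hp T.1 (hEI hT).2 T.2).1 (hES hT)).1)
      (fun h => ((hp T.1 hTY hTr).1 hTm).2 (le_trans (toDual_le_toDual.2 hZT) h))
    have r1 : finrank K V - finrank K (ofDual b₁ : Submodule K V) =
      finrank K V - finrank K Y + 2 := h1.2.2.1
    have r2 : finrank K V - finrank K (ofDual b₂ : Submodule K V) =
      finrank K V - finrank K Y + 2 := h2.2.2.1
    obtain ⟨x, x1, x2⟩ := c.surj (ofDual b₁) Y
      ((hpair (ofDual b₁) h1.1 (by omega)).2 ⟨h1.2.1, h1.2.2.2⟩)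
    obtain ⟨y, y1, y2⟩ := c.surj (ofDual b₂) Y
      ((hpair (ofDual b₂) h2.1 (by omega)).2 ⟨h2.2.1, h2.2.2.2⟩)
    have b1U : ofDual b₁ ≤ U.1 := h1'
    have b2U : ofDual b₂ ≤ U.1 := h2'
    have b1Z : Z ≤ ofDual b₁ := h1''
    have b2Z : Z ≤ ofDual b₂ := h2''
    exact ⟨x, y, fun h => hb (by
        have : ofDual b₁ = ofDual b₂ := by rw [← x1, ← y1, h]
        exact this), Or.inr (x2.trans y2.symm),
      ⟨x1 ▸ b1U, x2 ▸ hU.2⟩, ⟨y1 ▸ b2U, y2 ▸ hU.2⟩, ⟨x1 ▸ b1Z, x2.le⟩, ⟨y1 ▸ b2Z, y2.le⟩⟩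

theorem share_of_le {x y : SpineLine k m W} {Z Y : Submodule K V}
    (hr : (finrank K Z + 1 = k ∧ finrank K Y = k + 2) ∨
      (finrank K Z + 2 = k ∧ finrank K Y = k + 1))
    (hx : Z ≤ c.lower x ∧ c.upper x ≤ Y) (hy : Z ≤ c.lower y ∧ c.upper y ≤ Y) :
    c.Share x y := by
  have hxl := c.finrank_lower x
  have hyl := c.finrank_lower y
  have hxu := c.finrank_upper x
  have hyu := c.finrank_upper y
  rcases hr with ⟨h1, h2⟩ | ⟨h1, h2⟩
  · left
    rw [← Submodule.eq_of_le_of_finrank_eq hx.1 (by omega),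
      ← Submodule.eq_of_le_of_finrank_eq hy.1 (by omega)]
  · right
    rw [Submodule.eq_of_le_of_finrank_eq hx.2 (by omega),
      Submodule.eq_of_le_of_finrank_eq hy.2 (by omega)]

theorem adj_of_le {x y : SpineLine k m W} {Z Y : Submodule K V}
    (hr : (finrank K Z + 1 = k ∧ finrank K Y = k + 2) ∨
      (finrank K Z + 2 = k ∧ finrank K Y = k + 1))
    (hx : Z ≤ c.lower x ∧ c.upper x ≤ Y) (hy : Z ≤ c.lower y ∧ c.upper y ≤ Y) : c.Adj x y := by
  refine ⟨share_of_le c hr hx hy, ?_⟩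
  have hxl := c.finrank_lower x
  have hyl := c.finrank_lower y
  have hxu := c.finrank_upper x
  have hyu := c.finrank_upper y
  have lx := c.lower_le x
  have ly := c.lower_le y
  have e1 := rk_le_rk_inf hx.2 hy.2
  have e2 := rk_sup_add_inf (c.lower x) (c.lower y)
  have e3 := rk_mono (le_inf hx.1 hy.1)
  simp only [rk_eq] at e1 e2 e3
  rcases share_of_le c hr hx hy with h | h
  · obtain ⟨U, h1, h2, h3⟩ := exists_between (r := k)
      (le_inf lx (h ▸ ly) : _ ≤ c.upper x ⊓ c.upper y)
      (by rw [rk_eq]; omega) (by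
        rw [rk_eq]
        rcases hr with hr | hr
        · omega
        · have := Submodule.eq_of_le_of_finrank_eq hx.2 (by omega)
          have := Submodule.eq_of_le_of_finrank_eq hy.2 (by omega)
          have e : c.upper x ⊓ c.upper y = Y := by rw [‹c.upper x = Y›, ‹c.upper y = Y›, inf_idem]
          rw [e]
          omega)
    exact ⟨U, h3, ⟨h1, h2.trans inf_le_left⟩, ⟨h ▸ h1, h2.trans inf_le_right⟩⟩
  · obtain ⟨U, h1, h2, h3⟩ := exists_between (r := k)
      (sup_le lx (h ▸ ly) : c.lower x ⊔ c.lower y ≤ _)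
      (by
        rw [rk_eq]
        rcases hr with hr | hr
        · have := Submodule.eq_of_le_of_finrank_eq hx.1 (by omega)
          have := Submodule.eq_of_le_of_finrank_eq hy.1 (by omega)
          have e : c.lower x ⊔ c.lower y = Z := by
            rw [← ‹Z = c.lower x›, ← ‹Z = c.lower y›, sup_idem]
          rw [e]
          omega
        · omega)
      (by rw [rk_eq]; omega)
    exact ⟨U, h3, ⟨le_sup_left.trans h1, h2⟩, ⟨le_sup_right.trans h1, h ▸ h2⟩⟩

/-- The formula for pencils describes the lines through the common point `U` of `x` and `y` in the
plane that they span. -/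
theorem inPencil_iff (hn : k + 3 ≤ finrank K V) (hk : m + 3 ≤ k) {x y l : SpineLine k m W}
    (hne : x ≠ y) (hxy : c.Share x y)
    {U : Submodule K V} (hU : finrank K U = k) (hx : c.Thru U x) (hy : c.Thru U y) :
    InPencil c.Adj l x y ↔ c.Thru U l ∧ c.lower x ⊓ c.lower y ≤ c.lower l ∧
      c.upper l ≤ c.upper x ⊔ c.upper y := by
  have hxl := c.finrank_lower x
  have hll := c.finrank_lower l
  have hxu := c.finrank_upper x
  have hlu := c.finrank_upper l
  rcases hxy with h | h
  · rw [c.inPencil_iff_of_lower hn hk hne h ⟨Or.inl h, U, hU, hx, hy⟩,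
      c.inf_eq_of_thru hne h hU hx hy, ← h, inf_idem]
    constructor
    · rintro ⟨h1, h2, h3⟩
      exact ⟨⟨h1 ▸ hx.1, h2⟩, h1.ge, h3⟩
    · rintro ⟨h1, h2, h3⟩
      exact ⟨(Submodule.eq_of_le_of_finrank_eq h2 (by omega)).symm, h1.2, h3⟩
  · rw [c.inPencil_iff_of_upper hn hk hne h ⟨Or.inr h, U, hU, hx, hy⟩,
      c.sup_eq_of_thru hne h hU hx hy, ← h, sup_idem]
    constructor
    · rintro ⟨h1, h2, h3⟩
      exact ⟨⟨h2, h1 ▸ hx.2⟩, h3, h1.le⟩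
    · rintro ⟨h1, h2, h3⟩
      exact ⟨Submodule.eq_of_le_of_finrank_eq h3 (by omega), h1.1, h2⟩

-- `c` assigns to a line the pair `(H, B)` that spans it.
variable (hc : ∀ l : SpineLine k m W,
  l.1 = grassIcc k (c.lower l) (c.upper l) ∩ spinePoints k m W ∧
    spClosure (grassLines K V k) l.1 = grassIcc k (c.lower l) (c.upper l))
include hc

/-- Two lines of a star or top that meet span a plane of the spine space. -/
theorem exists_plane_of_share (hn : k + 3 ≤ finrank K V) (hk : m + 3 ≤ k) {x y : SpineLine k m W}
    (hne : x ≠ y) (hxy : c.Share x y) {U : Submodule K V} (hU : finrank K U = k)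
    (hx : c.Thru U x) (hy : c.Thru U y) :
    ∃ E, IsFragmentPlane (grassLines K V k) (spinePoints k m W) E ∧ x.1 ⊆ E ∧ y.1 ⊆ E ∧
      spClosure (grassLines K V k) E =
        grassIcc k (c.lower x ⊓ c.lower y) (c.upper x ⊔ c.upper y) := by
  have hxl := c.finrank_lower x
  have hyl := c.finrank_lower y
  have hxu := c.finrank_upper x
  have hyu := c.finrank_upper y
  have hxle := c.lower_le x
  -- The interval is a plane, and each of its points is on a line of the spine space in it.
  have key : IsPlane (grassLines K V k)
        (grassIcc k (c.lower x ⊓ c.lower y) (c.upper x ⊔ c.upper y)) ∧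
      ∀ T ∈ grassIcc k (c.lower x ⊓ c.lower y) (c.upper x ⊔ c.upper y), ∃ l, c.Thru T.1 l ∧
        c.lower x ⊓ c.lower y ≤ c.lower l ∧ c.upper l ≤ c.upper x ⊔ c.upper y := by
    rcases hxy with h | h
    · have h1 := Submodule.finrank_sup_add_finrank_inf_eq (c.upper x) (c.upper y)
      rw [c.inf_eq_of_thru hne h hU hx hy] at h1
      rw [← h, inf_idem]
      refine ⟨isPlane_grassIcc_star (hxle.trans le_sup_left) hxl (by omega), fun T hT => ?_⟩
      have hTr := T.2
      obtain ⟨t, d, hs, -⟩ := c.exists_isSheet_star hn x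
      have sx := hs.slit x rfl
      have sy := hs.slit y h.symm
      obtain ⟨b, -, -, ⟨hb, hTb, hbY⟩, -⟩ := exists_two_slitLines (t := t) (d := d) hT.1
        (by rw [rk_eq, rk_eq]; omega) hT.2 (by rw [rk_eq, rk_eq]; omega)
        (sup_le sx.2.1 sy.2.1) (fun h => sx.2.2.2 (le_sup_left.trans h))
      obtain ⟨l, hl, rfl⟩ := hs.surj b hb
      have hl : c.lower l = c.lower x := hl
      exact ⟨l, ⟨hl ▸ hT.1, hTb⟩, hl.ge, hbY⟩
    · have h1 := Submodule.finrank_sup_add_finrank_inf_eq (c.lower x) (c.lower y)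
      rw [c.sup_eq_of_thru hne h hU hx hy] at h1
      rw [← h, sup_idem]
      refine ⟨isPlane_grassIcc_top (inf_le_left.trans hxle) (by omega) hxu, fun T hT => ?_⟩
      have hTr := T.2
      obtain ⟨t, d, hs, -⟩ := c.exists_isSheet_top hn hk x
      have sx := hs.slit x rfl
      have sy := hs.slit y h.symm
      obtain ⟨b, -, -, ⟨hb, hTb, hbY⟩, -⟩ := exists_two_slitLines (t := t) (d := d)
        (y := toDual (c.lower x ⊓ c.lower y)) (toDual_le_toDual.2 hT.2)
        (by rw [rk_toDual, rk_toDual]; omega) (toDual_le_toDual.2 hT.1)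
        (by rw [rk_toDual, rk_toDual]; omega)
        (sup_le sx.2.1 sy.2.1) (fun h => sx.2.2.2 (le_sup_left.trans h))
      obtain ⟨l, hl, rfl⟩ := hs.surj b hb
      have hl : c.upper l = c.upper x := hl
      exact ⟨l, ⟨hTb, hl ▸ hT.2⟩, hbY, hl.le⟩
  set I := grassIcc k (c.lower x ⊓ c.lower y) (c.upper x ⊔ c.upper y) with hI
  have sub : ∀ l, c.lower x ⊓ c.lower y ≤ c.lower l → c.upper l ≤ c.upper x ⊔ c.upper y →
      l.1 ⊆ I ∩ spinePoints k m W := fun l h1 h2 T hT => by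
    rw [(hc l).1] at hT
    exact ⟨⟨h1.trans hT.1.1, hT.1.2.trans h2⟩, hT.2⟩
  have hcl : spClosure (grassLines K V k) (I ∩ spinePoints k m W) = I := by
    refine (spClosure_subset isSubspace_grassIcc Set.inter_subset_left).antisymm fun T hT => ?_
    obtain ⟨l, hTl, h1, h2⟩ := key.2 T hT
    have h3 := spClosure_mono (𝓛 := grassLines K V k) (sub l h1 h2)
    rw [(hc l).2] at h3
    exact h3 hTl
  refine ⟨I ∩ spinePoints k m W, ⟨Set.inter_subset_right, ?_, hcl.symm ▸ key.1⟩,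
    sub x inf_le_left le_sup_left, sub y inf_le_right le_sup_right, hcl⟩
  rintro l ⟨g, hg, rfl, -⟩ hnt
  refine Set.inter_subset_inter_left _ (isSubspace_grassIcc g hg (hnt.mono ?_))
  exact Set.inter_subset_inter Set.inter_subset_left Set.inter_subset_left

theorem le_and_le_of_subset {l : SpineLine k m W} {E : Set (Grass K V k)} {Z Y : Submodule K V}
    (hE : spClosure (grassLines K V k) E = grassIcc k Z Y)
    (hl : spClosure (grassLines K V k) l.1 ⊆ spClosure (grassLines K V k) E) :
    Z ≤ c.lower l ∧ c.upper l ≤ Y := by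
  rw [hE, (hc l).2] at hl
  exact le_and_le_of_grassIcc_subset (c.lower_le l) (c.finrank_lower l) (c.finrank_upper l) hl

theorem mem_pencilAt_iff {l : SpineLine k m W} {E : Set (Grass K V k)} {Z Y : Submodule K V}
    (hE : spClosure (grassLines K V k) E = grassIcc k Z Y) {U : Grass K V k} :
    l ∈ pencilAt (grassLines K V k) (spinePoints k m W) U E ↔
      c.Thru U.1 l ∧ Z ≤ c.lower l ∧ c.upper l ≤ Y := by
  constructor
  · rintro ⟨h1, h2⟩
    rw [(hc l).2] at h1
    exact ⟨h1, le_and_le_of_subset c hc hE h2⟩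
  · rintro ⟨h1, h2⟩
    refine ⟨(hc l).2 ▸ h1, ?_⟩
    rw [hE, (hc l).2]
    exact fun T hT => ⟨h2.1.trans hT.1, hT.2.trans h2.2⟩

variable (hn : k + 3 ≤ finrank K V) (hk : m + 3 ≤ k)
include hn hk

theorem spinePi_eq : spinePi k m W = c.Adj := by
  funext x y
  refine propext ⟨?_, ?_⟩
  · rintro ⟨E, hE, hx, hy⟩
    obtain ⟨Z, Y, hcl, hr, -⟩ := exists_two_lines_of_plane c hn hk hE
    exact adj_of_le c hr (le_and_le_of_subset c hc hcl (spClosure_mono hx))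
      (le_and_le_of_subset c hc hcl (spClosure_mono hy))
  · intro hxy
    have key : ∀ z, x ≠ z → c.Adj x z →
        ∃ E, IsFragmentPlane (grassLines K V k) (spinePoints k m W) E ∧ x.1 ⊆ E ∧ z.1 ⊆ E := by
      rintro z hne ⟨h, U, hU, h1, h2⟩
      obtain ⟨E, hE, hx, hz, -⟩ := exists_plane_of_share c hc hn hk hne h hU h1 h2
      exact ⟨E, hE, hx, hz⟩
    by_cases hne : x = y
    · obtain ⟨z, hxz, hadj⟩ := c.exists_pAdj hn hk x
      obtain ⟨E, hE, hx, -⟩ := key z hxz hadj.adj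
      exact ⟨E, hE, hx, hne ▸ hx⟩
    · exact key y hne hxy

theorem spineRho_eq : spineRho k m W = c.PAdj := by
  funext x y
  refine propext ⟨?_, ?_⟩
  · rintro ⟨_, ⟨E, U, hE, -, hUS, rfl⟩, hx, hy⟩
    obtain ⟨Z, Y, hcl, hr, -⟩ := exists_two_lines_of_plane c hn hk hE
    obtain ⟨hUx, hx⟩ := (mem_pencilAt_iff c hc hcl).1 hx
    obtain ⟨hUy, hy⟩ := (mem_pencilAt_iff c hc hcl).1 hy
    exact ⟨share_of_le c hr hx hy, U.1, U.2, hUS, hUx, hUy⟩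
  · intro hxy
    have key : ∀ z, x ≠ z → c.PAdj x z → ∃ p ∈ properPencils (grassLines K V k)
        (spinePoints k m W), x ∈ p ∧ z ∈ p := by
      rintro z hne ⟨h, U, hU, hUm, h1, h2⟩
      obtain ⟨E, hE, -, -, hcl⟩ := exists_plane_of_share c hc hn hk hne h hU h1 h2
      exact ⟨_, ⟨E, ⟨U, hU⟩, hE, hcl ▸ ⟨inf_le_left.trans h1.1, h1.2.trans le_sup_left⟩, hUm, rfl⟩,
        (mem_pencilAt_iff c hc hcl).2 ⟨h1, inf_le_left, le_sup_left⟩,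
        (mem_pencilAt_iff c hc hcl).2 ⟨h2, inf_le_right, le_sup_right⟩⟩
    by_cases hne : x = y
    · obtain ⟨z, hxz, hadj⟩ := c.exists_pAdj hn hk x
      obtain ⟨p, hp, hx, -⟩ := key z hxz hadj
      exact ⟨p, hp, hx, hne ▸ hx⟩
    · exact key y hne hxy

/-- The pencils with a vertex in `S` are given by the formula `InPencil`, with parameters two
distinct lines that meet in a point of `S`. -/
theorem exists_pencilAt_iff (S : Set (Grass K V k)) (p : Set (SpineLine k m W)) :
    (∃ E U, IsFragmentPlane (grassLines K V k) (spinePoints k m W) E ∧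
      U ∈ spClosure (grassLines K V k) E ∧ U ∈ S ∧
        p = pencilAt (grassLines K V k) (spinePoints k m W) U E) ↔
    ∃ x y, (x ≠ y ∧ c.Share x y ∧ ∃ U ∈ S, c.Thru U.1 x ∧ c.Thru U.1 y) ∧
      ∀ l, l ∈ p ↔ InPencil c.Adj l x y := by
  constructor
  · rintro ⟨E, U, hE, hUE, hUS, rfl⟩
    obtain ⟨Z, Y, hcl, hr, hex⟩ := exists_two_lines_of_plane c hn hk hE
    rw [hcl] at hUE
    obtain ⟨x, y, hne, hxy, hx, hy, ⟨x1, x2⟩, ⟨y1, y2⟩⟩ := hex U hUE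
    refine ⟨x, y, ⟨hne, hxy, U, hUS, hx, hy⟩, fun l => ?_⟩
    have hU := U.2
    have hxl := c.finrank_lower x
    have hyl := c.finrank_lower y
    have hxu := c.finrank_upper x
    have hyu := c.finrank_upper y
    have e1 := Submodule.finrank_sup_add_finrank_inf_eq (c.lower x) (c.lower y)
    have e2 := Submodule.finrank_sup_add_finrank_inf_eq (c.upper x) (c.upper y)
    have e3 := Submodule.finrank_mono (le_inf x1 y1)
    have e4 := Submodule.finrank_mono (sup_le x2 y2)
    have e5 : Z = c.lower x ⊓ c.lower y ∧ c.upper x ⊔ c.upper y = Y := by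
      rcases hxy with h | h
      · rw [c.inf_eq_of_thru hne h hU hx hy] at e2
        have e6 : c.lower x ⊓ c.lower y = c.lower x := by rw [← h, inf_idem]
        rw [e6] at e3
        exact ⟨Submodule.eq_of_le_of_finrank_le (le_inf x1 y1) (by rw [e6]; omega),
          Submodule.eq_of_le_of_finrank_le (sup_le x2 y2) (by omega)⟩
      · rw [c.sup_eq_of_thru hne h hU hx hy] at e1
        have e6 : c.upper x ⊔ c.upper y = c.upper x := by rw [← h, sup_idem]
        rw [e6] at e4
        exact ⟨Submodule.eq_of_le_of_finrank_le (le_inf x1 y1) (by omega),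
          Submodule.eq_of_le_of_finrank_le (sup_le x2 y2) (by rw [e6]; omega)⟩
    rw [mem_pencilAt_iff c hc hcl, inPencil_iff c hn hk hne hxy hU hx hy, e5.1, e5.2]
  · rintro ⟨x, y, ⟨hne, hxy, U, hUS, hx, hy⟩, hp⟩
    obtain ⟨E, hE, -, -, hcl⟩ := exists_plane_of_share c hc hn hk hne hxy U.2 hx hy
    refine ⟨E, U, hE, hcl ▸ ⟨inf_le_left.trans hx.1, hx.2.trans le_sup_left⟩, hUS,
      Set.ext fun l => ?_⟩
    rw [hp, mem_pencilAt_iff c hc hcl, inPencil_iff c hn hk hne hxy U.2 hx hy]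

variable (hcodim : k + finrank K W ≤ m + finrank K V)
include hcodim

/-- The families of pencils are definable in every structure in which coplanarity is definable. -/
theorem definableFamily_of_isDef_adj {R : SpineLine k m W → SpineLine k m W → Prop}
    (hR : IsDef₂ R c.Adj) :
    DefinableFamily R (spinePencils k m W ∪ spineParallelPencils k m W) ∧
      DefinableFamily R (spineParallelPencils k m W) ∧
      DefinableFamily R (spinePencils k m W) := by
  have impr : ∀ x y, x ≠ y → ((c.Share x y ∧
      ∃ U ∈ (spinePoints k m W)ᶜ, c.Thru U.1 x ∧ c.Thru U.1 y) ↔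
      c.Adj x y ∧ Improper c.Adj x y) := by
    intro x y hne
    constructor
    · rintro ⟨h, U, hUS, hx, hy⟩
      exact ⟨⟨h, U.1, U.2, hx, hy⟩, (c.improper_iff hn hk hcodim hne h U.2 hx hy).2 hUS⟩
    · rintro ⟨⟨h, U, hU, hx, hy⟩, hI⟩
      exact ⟨h, ⟨U, hU⟩, (c.improper_iff hn hk hcodim hne h hU hx hy).1 hI, hx, hy⟩
  have prop : ∀ x y, x ≠ y → ((c.Share x y ∧
      ∃ U ∈ spinePoints k m W, c.Thru U.1 x ∧ c.Thru U.1 y) ↔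
      c.Adj x y ∧ ¬ Improper c.Adj x y) := by
    intro x y hne
    constructor
    · rintro ⟨h, U, hUS, hx, hy⟩
      exact ⟨⟨h, U.1, U.2, hx, hy⟩,
        fun hI => (c.improper_iff hn hk hcodim hne h U.2 hx hy).1 hI hUS⟩
    · rintro ⟨⟨h, U, hU, hx, hy⟩, hI⟩
      exact ⟨h, ⟨U, hU⟩, not_not.1 fun hU' =>
        hI ((c.improper_iff hn hk hcodim hne h hU hx hy).2 hU'), hx, hy⟩
  have hparallel : ∀ p, p ∈ spineParallelPencils k m W ↔ ∃ x y,
      (x ≠ y ∧ c.Adj x y ∧ Improper c.Adj x y) ∧ ∀ l, l ∈ p ↔ InPencil c.Adj l x y := fun p =>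
    (exists_pencilAt_iff c hc hn hk (spinePoints k m W)ᶜ p).trans <| exists_congr fun x =>
      exists_congr fun y => and_congr_left fun _ => and_congr_right fun hne => impr x y hne
  have hproper : ∀ p, p ∈ spinePencils k m W ↔ ∃ x y,
      (x ≠ y ∧ c.Adj x y ∧ ¬ Improper c.Adj x y) ∧ ∀ l, l ∈ p ↔ InPencil c.Adj l x y := fun p =>
    (exists_pencilAt_iff c hc hn hk (spinePoints k m W) p).trans <| exists_congr fun x =>
      exists_congr fun y => and_congr_left fun _ => and_congr_right fun hne => prop x y hne
  refine ⟨definableFamily_of_isDef (D := fun x y => x ≠ y ∧ c.Adj x y)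
      ((IsDef.eq _ _).not.and (hR.app _ _)) hR.inPencil fun p => ?_,
    definableFamily_of_isDef (D := fun x y => x ≠ y ∧ c.Adj x y ∧ Improper c.Adj x y)
      ((IsDef.eq _ _).not.and ((hR.app _ _).and (hR.improper.app _ _))) hR.inPencil hparallel,
    definableFamily_of_isDef (D := fun x y => x ≠ y ∧ c.Adj x y ∧ ¬ Improper c.Adj x y)
      ((IsDef.eq _ _).not.and ((hR.app _ _).and (hR.improper.app _ _).not)) hR.inPencil hproper⟩
  rw [Set.mem_union, hparallel, hproper]
  constructor
  · rintro (⟨x, y, ⟨h1, h2, -⟩, h3⟩ | ⟨x, y, ⟨h1, h2, -⟩, h3⟩)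
    · exact ⟨x, y, ⟨h1, h2⟩, h3⟩
    · exact ⟨x, y, ⟨h1, h2⟩, h3⟩
  · rintro ⟨x, y, ⟨h1, h2⟩, h3⟩
    by_cases hI : Improper c.Adj x y
    · exact Or.inr ⟨x, y, ⟨h1, h2, hI⟩, h3⟩
    · exact Or.inl ⟨x, y, ⟨h1, h2, hI⟩, h3⟩

end Spine

end LinePencils

theorem mainTheorem2 {K V : Type*} [DivisionRing K] [AddCommGroup V] [Module K V]
    [FiniteDimensional K V] (W : Submodule K V) (k m : ℕ)
    (hcodim : k + Module.finrank K W ≤ m + Module.finrank K V)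
    (hmk : m ≤ k) (hmW : m ≤ Module.finrank K W)
    (hn : k + 3 ≤ Module.finrank K V) (hk : m + 3 ≤ k) :
    (LinePencils.DefinableFamily (LinePencils.spinePi k m W)
        (LinePencils.spinePencils k m W ∪ LinePencils.spineParallelPencils k m W) ∧
      LinePencils.DefinableFamily (LinePencils.spinePi k m W)
        (LinePencils.spineParallelPencils k m W) ∧
      LinePencils.DefinableFamily (LinePencils.spinePi k m W)
        (LinePencils.spinePencils k m W)) ∧
    LinePencils.DefinableFamily (LinePencils.spineRho k m W)
      (LinePencils.spinePencils k m W) := by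
  obtain ⟨c, hc⟩ := LinePencils.exists_spineCoords (W := W) (k := k) (m := m) hn
  rw [LinePencils.spinePi_eq c hc hn hk, LinePencils.spineRho_eq c hc hn hk]
  refine ⟨LinePencils.definableFamily_of_isDef_adj c hc hn hk hcodim LinePencils.isDef₂_self,
    (LinePencils.definableFamily_of_isDef_adj c hc hn hk hcodim ?_).2.2⟩
  -- Coplanarity is definable from `ρ`.
  have h : LinePencils.CoplanarFrom c.PAdj = c.Adj :=
    funext fun x => funext fun y => propext (c.coplanarFrom_iff hn hk hcodim)
  exact h ▸ LinePencils.isDef₂_self.coplanarFrom
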